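/- **Setting.** There are $K\ge 2$ arms and $T$ rounds. In round $t$ the environment generates a loss vector $\ell_t\in[0,1]^K$, possibly at random and depending on the past but not on the learner's fresh randomness of round $t$. The learner exploits an arm $i_t$ (suffering $\ell_{t,i_t}$, unobserved) and explores an arm $j_t$ (observing $\ell_{t,j_t}$). The pseudo-regret is $\mathrm{Reg}(T)=\mathbb E\big[\sum_{t=1}^T\ell_{t,i_t}\big]-\min_i\mathbb E\big[\sum_{t=1}^T\ell_{t,i}\big]$. In the stochastically constrained adversarial regime there are fixed numbers $\Delta_{i,j}$ such that, for all $t\in\{1,\dots,T\}$ and all $i,j$, the conditional expectation of $\ell_{t,i}-\ell_{t,j}$ given the history before round $t$ equals $\Delta_{i,j}$. The arm $i^*$ is the unique best arm if $\Delta_i:=\Delta_{i,i^*}>0$ for all $i\ne i^*$; let $\Delta_{\min}=\min_{i\ne i^*}\Delta_i$. **Algorithm** (shape $\alpha$, learning rates $\eta_t$). Start with $\hat L_1=0\in\mathbb R^K$. In round $t$, draw $r_{t,1},\dots,r_{t,K}$ i.i.d. from the Pareto distribution with density $\alpha x^{-\alpha-1}$ on $[1,\infty)$ and exploit $i_t\in\arg\min_i\{\hat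 L_{t,i}-r_{t,i}/\eta_t\}$. Explore $j_t$ drawn with probabilities $p_{t,i}=q_{t,i}/\sum_j q_{t,j}$, where $$q_{t,i}=\Big(\min\Big\{\frac1{1+\eta_t(\hat L_{t,i}-\min_k\hat L_{t,k})},\ \frac1{\sigma_{t,i}^{1/\alpha}}\Big\}\Big)^{\frac{\alpha+1}2}$$ and $\sigma_{t,i}\in\{1,\dots,K\}$ is the rank of $\hat L_{t,i}$ in increasing order (ties broken arbitrarily). Then set $\hat L_{t+1}=\hat L_t+\ell_{t,j_t}p_{t,j_t}^{-1}e_{j_t}$. **Theorem.** Let $\alpha\in(1,3]$ and $c>0$. There is a constant $C>0$, depending only on $\alpha$ and $c$, such that for all $K\ge2$ and $T$, for every environment in the stochastically constrained adversarial regime with a unique best arm $i^*$, the algorithm with $\eta_t=cK^{\frac1\alpha-\frac12}/\sqrt t$ satisfies $$\mathrm{Reg}(T)\le C\Big(\sum_{t=1}^T\sum_{i\ne i^*}\sqrt K\,\Delta_i^{1-\alpha}t^{-\alpha/2}+\frac K{\Delta_{\min}}\Big).$$ If moreover $\alpha\in(2,3]$, then $C$ can be chosen so that also, with a right-hand side independent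 of $T$, $$\mathrm{Reg}(T)\le C\Big(\sum_{i\ne i^*}\sqrt K\,\Delta_i^{1-\alpha}+\frac K{\Delta_{\min}}\Big)\qquad\text{for all }T.$$ -/

import Mathlib

open MeasureTheory ProbabilityTheory

/-- The loss gap `L i - min_k L k` of a vector of (estimated) cumulative losses. -/
noncomputable def lossGap {K : ℕ} (L : Fin K → ℝ) (i : Fin K) : ℝ :=
  L i - ⨅ k, L k

/-- The unnormalised exploration weight
`q_i = ((1 / (1 + η * gap_i)) ∧ (1 / σ_i ^ (1 / α))) ^ ((α + 1) / 2)`,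
where `σ i` is the rank (from `1` for the smallest to `K` for the largest) of `L i`. -/
noncomputable def exploreWeight {K : ℕ} (α η : ℝ) (L : Fin K → ℝ) (σ : Fin K → ℕ)
    (i : Fin K) : ℝ :=
  (min (1 / (1 + η * lossGap L i)) (1 / (σ i : ℝ) ^ (1 / α))) ^ ((α + 1) / 2)

/-- The exploration probability `p_i = q_i / ∑ j, q_j`. -/
noncomputable def exploreProb {K : ℕ} (α η : ℝ) (L : Fin K → ℝ) (σ : Fin K → ℕ)
    (i : Fin K) : ℝ :=
  exploreWeight α η L σ i / ∑ j, exploreWeight α η L σ j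

/-- `σ` is a ranking of the entries of `L` in increasing order, with values `1, …, K`;
ties are broken arbitrarily. -/
def IsRanking {K : ℕ} (L : Fin K → ℝ) (σ : Fin K → ℕ) : Prop :=
  Set.BijOn σ Set.univ (Set.Icc 1 K) ∧ ∀ i j, L i < L j → σ i < σ j

/-- A run, over the rounds `1, …, T`, of follow-the-perturbed-leader with Pareto perturbations
of shape `α` and learning rates `η t`, for decoupled exploration and exploitation with `K` arms,
against an arbitrary (possibly randomised and adaptive) environment, on a probability space
`(Ω, P)`.

`history t` is the information that is available before round `t`. It contains everything that the
learner has drawn and observed in the earlier rounds, and possibly more (such as private randomness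
of the environment, or unobserved past losses). In round `t` the loss vector is generated in an
arbitrary way that may depend on `history t`, but not on the randomness that the learner uses
in round `t`. -/
structure FTPLRun {Ω : Type*} [mΩ : MeasurableSpace Ω] (P : Measure Ω) (K T : ℕ) (α : ℝ)
    (η : ℕ → ℝ) where
  /-- the information available before round `t` -/
  history : Filtration ℕ mΩ
  /-- the loss vector of round `t` -/
  loss : ℕ → Ω → Fin K → ℝ
  /-- the perturbation vector of round `t` -/
  pert : ℕ → Ω → Fin K → ℝ
  /-- the arm exploited in round `t` -/
  exploit : ℕ → Ω → Fin K
  /-- the arm explored in round `t` -/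
  explore : ℕ → Ω → Fin K
  /-- the estimated cumulative losses before round `t` -/
  lhat : ℕ → Ω → Fin K → ℝ
  /-- the ranks of the estimated cumulative losses before round `t` -/
  rank : ℕ → Ω → Fin K → ℕ
  -- the losses are random variables with values in `[0, 1]`
  measurable_loss : ∀ t ∈ Finset.Icc 1 T, Measurable (loss t)
  loss_mem : ∀ t ∈ Finset.Icc 1 T, ∀ ω i, loss t ω i ∈ Set.Icc (0 : ℝ) 1
  -- what the learner draws and observes in round `t` belongs to the history of the next round
  measurable_pert : ∀ t ∈ Finset.Icc 1 T, Measurable[history (t + 1)] (pert t)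
  measurable_exploit : ∀ t ∈ Finset.Icc 1 T, Measurable[history (t + 1)] (exploit t)
  measurable_explore : ∀ t ∈ Finset.Icc 1 T, Measurable[history (t + 1)] (explore t)
  measurable_observed : ∀ t ∈ Finset.Icc 1 T,
    Measurable[history (t + 1)] (fun ω => loss t ω (explore t ω))
  -- the ranks are computed from the history
  measurable_rank : ∀ t ∈ Finset.Icc 1 T, Measurable[history t] (rank t)
  isRanking : ∀ t ∈ Finset.Icc 1 T, ∀ ω, IsRanking (lhat t ω) (rank t ω)
  -- the perturbations are i.i.d. Pareto, and independent of the past and of the current losses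
  map_pert : ∀ t ∈ Finset.Icc 1 T, P.map (pert t) = Measure.pi (fun _ => paretoMeasure 1 α)
  indep_pert : ∀ t ∈ Finset.Icc 1 T,
    Indep (MeasurableSpace.comap (pert t) inferInstance)
      (history t ⊔ MeasurableSpace.comap (loss t) inferInstance) P
  -- exploitation: the perturbed leader
  exploit_argmin : ∀ t ∈ Finset.Icc 1 T, ∀ ω k,
    lhat t ω (exploit t ω) - pert t ω (exploit t ω) / η t ≤ lhat t ω k - pert t ω k / η t
  -- exploration: a fresh draw from the exploration probabilities
  condExp_explore : ∀ t ∈ Finset.Icc 1 T, ∀ i,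
    P[(explore t ⁻¹' {i}).indicator (fun _ => (1 : ℝ)) |
        history t ⊔ MeasurableSpace.comap (loss t) inferInstance ⊔
          MeasurableSpace.comap (pert t) inferInstance]
      =ᵐ[P] fun ω => exploreProb α (η t) (lhat t ω) (rank t ω) i
  -- importance-weighted estimation of the cumulative losses
  lhat_one : ∀ ω, lhat 1 ω = 0
  lhat_succ : ∀ t ∈ Finset.Icc 1 T, ∀ ω,
    lhat (t + 1) ω = lhat t ω + Pi.single (explore t ω)
      (loss t ω (explore t ω) / exploreProb α (η t) (lhat t ω) (rank t ω) (explore t ω))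

namespace FTPLRun

variable {Ω : Type*} [MeasurableSpace Ω] {P : Measure Ω} {K T : ℕ} {α : ℝ} {η : ℕ → ℝ}

/-- The pseudo-regret `E[∑_t ℓ_{t, i_t}] - min_i E[∑_t ℓ_{t, i}]` over the rounds `1, …, T`. -/
noncomputable def pseudoRegret (R : FTPLRun P K T α η) : ℝ :=
  (∫ ω, ∑ t ∈ Finset.Icc 1 T, R.loss t ω (R.exploit t ω) ∂P)
    - ⨅ i : Fin K, ∫ ω, ∑ t ∈ Finset.Icc 1 T, R.loss t ω i ∂P

/-- The stochastically constrained adversarial regime: in every round, whatever the past, the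
expected losses (given the past) of arms `i` and `j` differ by the fixed number `Δ i j`. -/
def IsStochasticallyConstrained (R : FTPLRun P K T α η) (Δ : Fin K → Fin K → ℝ) : Prop :=
  ∀ t ∈ Finset.Icc 1 T, ∀ i j,
    P[fun ω => R.loss t ω i - R.loss t ω j | R.history t] =ᵐ[P] fun _ => Δ i j

end FTPLRun

/-! Let `w_{t,i}` be the probability, given the past, that fresh perturbations make arm `i` the
leader in round `t`. The constrained regime bounds the regret by `X = ∑_t ∑_{i ≠ i*} Δ_i
E[w_{t,i}]`. Importance weighting is unbiased, so losses may be replaced by their estimates, and the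
be-the-leader argument bounds the same `X` by a penalty (for the changes of the learning rate) plus
a stability term (for not knowing the current estimate). Each is at most `X / 4` plus admissible
terms, and `X ≤ X / 2 + R` gives `X ≤ 2 R`.

Penalty. Over an event of probability `w`, a Pareto variable integrates to `O(w ^ (1 - 1/α))`
(`setIntegral_eval_paretoPi_le`). The perturbation of `i*` cancels against that of the comparator,
so only arms `i ≠ i*` pay, and a Young inequality turns `(1/η_t - 1/η_{t-1}) w ^ (1 - 1/α)` into
`Δ_i w / 4` plus a multiple of `√K Δ_i ^ (1 - α) t ^ (-α/2)`.

Stability. With the other perturbations fixed, raising the loss of arm `i` by `x` costs it the lead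
only if `r_i` falls in a window of length `x`. The Pareto density there is controlled by the gap of
`i`, and also by the maximum of the `σ_i - 1` perturbations of better ranked arms; the smaller bound
is of order `q_i ^ 2` (`winProb_sub_le_exploreWeight_sq`). The shift is at most `η Q / q_i` with `Q
= ∑ q_j`, so one factor `q_i` cancels and the total is `O(η Q ^ 2) = O(v)`, where `v = √(K/t)`.

This coarse bound is not self-bounding. Put `W = 1 - w_{t,i*}`. If `W < 1/16`, then `i*` leads the
estimates, and the other weights sum to `O(K ^ ((1 - 1/α)/2) W ^ s)` with `s = (α+1)/(2α)`, where `s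
≥ 2/3` exactly because `α ≤ 3`. For small `v` the stability is therefore `O(v W ^ (2/3))`, and Young
with `D = Δ_min` gives `D W / 4 + O(v ^ 3 / D ^ 2)`. Together with the coarse bound, the remainder
is `min (v, v ^ 3 / D ^ 2)`, which sums over `t` to `O(K / D)`, the crossover being at `t ≈ K / D ^
2`. -/

/-! ### The Pareto law: tails, windows and truncated means -/

section Pareto

variable {α : ℝ}

instance nullSingletonClass_paretoMeasure (t r : ℝ) : NullSingletonClass (paretoMeasure t r) := by
  unfold paretoMeasure; infer_instance

theorem paretoPDF_one_of_le {x : ℝ} (hx : 1 ≤ x) :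
    paretoPDF 1 α x = ENNReal.ofReal (α * x ^ (-(α + 1))) := by
  rw [paretoPDF_of_le hx]; simp

theorem paretoMeasure_Iio_one : paretoMeasure 1 α (Set.Iio 1) = 0 := by
  rw [paretoMeasure, withDensity_apply _ measurableSet_Iio]
  exact lintegral_paretoPDF_of_le le_rfl

theorem ae_one_le_paretoMeasure : ∀ᵐ x ∂(paretoMeasure 1 α), 1 ≤ x := by
  rw [ae_iff]
  simpa [Set.Iio] using paretoMeasure_Iio_one (α := α)

theorem setLIntegral_Ioi_rpow {a B : ℝ} (ha : a < -1) (hB : 0 < B) :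
    ∫⁻ x in Set.Ioi B, ENNReal.ofReal (x ^ a) = ENNReal.ofReal (-B ^ (a + 1) / (a + 1)) := by
  rw [← integral_Ioi_rpow_of_lt ha hB,
    ofReal_integral_eq_lintegral_ofReal (integrableOn_Ioi_rpow_of_lt ha hB)]
  filter_upwards [ae_restrict_mem measurableSet_Ioi] with x hx
  exact Real.rpow_nonneg (hB.le.trans (le_of_lt hx)) _

theorem paretoMeasure_Ioi (hα : 0 < α) {y : ℝ} (hy : 1 ≤ y) :
    paretoMeasure 1 α (Set.Ioi y) = ENNReal.ofReal (y ^ (-α)) := by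
  rw [paretoMeasure, withDensity_apply _ measurableSet_Ioi,
    setLIntegral_congr_fun (g := fun x => ENNReal.ofReal α * ENNReal.ofReal (x ^ (-(α + 1))))
      measurableSet_Ioi, lintegral_const_mul' _ _ ENNReal.ofReal_ne_top,
    setLIntegral_Ioi_rpow (by linarith) (by linarith), ← ENNReal.ofReal_mul hα.le]
  · congr 1
    rw [show -(α + 1) + 1 = -α by ring]; field_simp
  · intro x hx
    have hx1 : 1 ≤ x := hy.trans (le_of_lt hx)
    simp only []
    rw [paretoPDF_one_of_le hx1, ENNReal.ofReal_mul hα.le]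

theorem paretoMeasure_real_Ioi (hα : 0 < α) {y : ℝ} (hy : 1 ≤ y) :
    (paretoMeasure 1 α).real (Set.Ioi y) = y ^ (-α) := by
  rw [measureReal_def, paretoMeasure_Ioi hα hy, ENNReal.toReal_ofReal]
  exact Real.rpow_nonneg (by linarith) _

/-- The density vanishes below `1` and decreases above it, so on the window it is at most its value
at any `b` between `1` and `max 1 m`. The form with `max 1 m` allows a window that starts below the
support. -/
theorem paretoMeasure_Ico_le (hα : 0 < α) {b m x : ℝ} (hb : 1 ≤ b) (hbm : b ≤ max 1 m) :
    paretoMeasure 1 α (Set.Ico m (m + x)) ≤ ENNReal.ofReal (α * x * b ^ (-(α + 1))) := by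
  rw [paretoMeasure, withDensity_apply _ measurableSet_Ico]
  calc ∫⁻ y in Set.Ico m (m + x), paretoPDF 1 α y
      ≤ ∫⁻ y in Set.Ico m (m + x), ENNReal.ofReal (α * b ^ (-(α + 1))) := by
        refine setLIntegral_mono measurable_const fun y hy => ?_
        rcases lt_or_ge y 1 with h | h
        · rw [paretoPDF_of_lt h]; exact zero_le
        · rw [paretoPDF_one_of_le h]
          refine ENNReal.ofReal_le_ofReal (mul_le_mul_of_nonneg_left ?_ hα.le)
          exact Real.rpow_le_rpow_of_nonpos (by linarith) (hbm.trans (max_le h hy.1))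
            (by linarith)
    _ = ENNReal.ofReal (α * x * b ^ (-(α + 1))) := by
        rw [setLIntegral_const, Real.volume_Ico, ← ENNReal.ofReal_mul (by positivity)]
        congr 1; ring

theorem setLIntegral_id_paretoMeasure_Ioi (hα : 1 < α) {B : ℝ} (hB : 1 ≤ B) :
    ∫⁻ x in Set.Ioi B, ENNReal.ofReal x ∂(paretoMeasure 1 α)
      = ENNReal.ofReal (α / (α - 1) * B ^ (1 - α)) := by
  have hm : Measurable (paretoPDF 1 α) := (measurable_paretoPDFReal 1 α).ennreal_ofReal
  have hα0 : 0 < α := by linarith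
  rw [paretoMeasure, setLIntegral_withDensity_eq_setLIntegral_mul _ hm ENNReal.measurable_ofReal
    measurableSet_Ioi,
    setLIntegral_congr_fun (g := fun x => ENNReal.ofReal α * ENNReal.ofReal (x ^ (-α)))
      measurableSet_Ioi, lintegral_const_mul' _ _ ENNReal.ofReal_ne_top,
    setLIntegral_Ioi_rpow (by linarith) (by linarith), ← ENNReal.ofReal_mul hα0.le]
  · congr 1
    have : α - 1 ≠ 0 := by linarith
    have : -α + 1 ≠ 0 := by linarith
    rw [show -α + 1 = 1 - α by ring] at *; field_simp; ring
  · intro x hx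
    have hx1 : 1 ≤ x := hB.trans (le_of_lt hx)
    have hx0 : 0 < x := by linarith
    simp only [Pi.mul_apply]
    rw [paretoPDF_one_of_le hx1, ← ENNReal.ofReal_mul (by positivity), ← ENNReal.ofReal_mul hα0.le]
    congr 1
    rw [mul_assoc]; congr 1
    nth_rewrite 2 [← Real.rpow_one x]
    rw [← Real.rpow_add hx0]; congr 1; ring

theorem integrable_id_paretoMeasure (hα : 1 < α) :
    Integrable (fun x : ℝ => x) (paretoMeasure 1 α) := by
  have := isProbabilityMeasure_paretoMeasure (t := 1) (r := α) one_pos (by linarith)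
  have hIoi : IntegrableOn (fun x : ℝ => x) (Set.Ioi 1) (paretoMeasure 1 α) := by
    refine ⟨measurable_id.aestronglyMeasurable, ?_⟩
    rw [hasFiniteIntegral_iff_ofReal, setLIntegral_id_paretoMeasure_Ioi hα le_rfl]
    · exact ENNReal.ofReal_lt_top
    · filter_upwards [ae_restrict_mem measurableSet_Ioi] with x hx
      exact zero_le_one.trans (le_of_lt hx)
  refine (integrable_const (1 : ℝ)).add (hIoi.integrable_indicator measurableSet_Ioi) |>.mono'
    measurable_id.aestronglyMeasurable ?_
  filter_upwards [ae_one_le_paretoMeasure] with x hx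
  rw [Real.norm_of_nonneg (by linarith)]
  by_cases h : 1 < x
  · simp [Set.indicator, h]
  · simp [Set.indicator, h]; linarith

theorem setIntegral_id_paretoMeasure_Ioi (hα : 1 < α) {B : ℝ} (hB : 1 ≤ B) :
    ∫ x in Set.Ioi B, x ∂(paretoMeasure 1 α) = α / (α - 1) * B ^ (1 - α) := by
  have hα1 : 0 < α - 1 := by linarith
  rw [integral_eq_lintegral_of_nonneg_ae, setLIntegral_id_paretoMeasure_Ioi hα hB,
    ENNReal.toReal_ofReal]
  · positivity
  · filter_upwards [ae_restrict_mem measurableSet_Ioi] with x hx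
    exact zero_le_one.trans (hB.trans (le_of_lt hx))
  · exact measurable_id.aestronglyMeasurable

end Pareto

/-! ### Resampling one coordinate of a product measure -/

section Resampling

variable {ι : Type*} [Fintype ι] [DecidableEq ι] {ν : ι → Measure ℝ}
  [∀ i, IsProbabilityMeasure (ν i)]

theorem lintegral_pi_update {f : (ι → ℝ) → ENNReal} (hf : Measurable f) (i : ι) :
    ∫⁻ r, f r ∂(Measure.pi ν) = ∫⁻ r, ∫⁻ y, f (Function.update r i y) ∂(ν i) ∂(Measure.pi ν) := by
  have key : ∀ r, (∫⋯∫⁻_{i}, f ∂ν) r = ∫⁻ y, f (Function.update r i y) ∂(ν i) :=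
    fun r => lmarginal_singleton f i ▸ rfl
  have hg : Measurable (∫⋯∫⁻_{i}, f ∂ν) := hf.lmarginal ν
  simp_rw [← key]
  refine lintegral_eq_of_lmarginal_eq {i} hf hg ?_
  funext r
  rw [lmarginal_singleton (∫⋯∫⁻_{i}, f ∂ν) i]
  simp [lmarginal_update_of_mem ν (Finset.mem_singleton_self i)]

/-- Redrawing coordinate `i` independently preserves the product law, so the measure of an event is
the mean of its one-dimensional sections. This is how "fix all other perturbations" is made
rigorous. -/
theorem measure_pi_le_of_update {A : Set (ι → ℝ)} (hA : MeasurableSet A) (i : ι)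
    {B : (ι → ℝ) → ENNReal}
    (hB : ∀ᵐ r ∂(Measure.pi ν), ν i {y | Function.update r i y ∈ A} ≤ B r) :
    Measure.pi ν A ≤ ∫⁻ r, B r ∂(Measure.pi ν) := by
  rw [← lintegral_indicator_one hA, lintegral_pi_update (measurable_one.indicator hA) i]
  refine lintegral_mono_ae ?_
  filter_upwards [hB] with r hr
  refine le_trans (le_of_eq ?_) hr
  have hm : MeasurableSet {y | Function.update r i y ∈ A} := (measurable_update r) hA
  rw [← lintegral_indicator_one hm]
  rfl

end Resampling

/-! ### Winning probabilities of perturbed leaders -/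

section Win

variable {K : ℕ} {α : ℝ}

/-- The law of `K` independent Pareto variables of shape `α` and scale `1`. -/
noncomputable abbrev paretoPi (K : ℕ) (α : ℝ) : Measure (Fin K → ℝ) :=
  Measure.pi fun _ => paretoMeasure 1 α

/-- The perturbation vectors `r` for which the arm `i` minimises `lam i - r i`. -/
def winSet (lam : Fin K → ℝ) (i : Fin K) : Set (Fin K → ℝ) :=
  {r | ∀ k, lam i - r i ≤ lam k - r k}

/-- The probability that the arm `i` minimises `lam i - r i`. -/
noncomputable def winProb (α : ℝ) (lam : Fin K → ℝ) (i : Fin K) : ℝ :=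
  (paretoPi K α).real (winSet lam i)

theorem measurableSet_winSet (lam : Fin K → ℝ) (i : Fin K) : MeasurableSet (winSet lam i) := by
  have : winSet lam i = ⋂ k, {r | lam i - r i ≤ lam k - r k} := by
    ext r; simp [winSet]
  rw [this]
  exact MeasurableSet.iInter fun k => measurableSet_le (by fun_prop) (by fun_prop)

theorem exists_mem_winSet [Nonempty (Fin K)] (lam r : Fin K → ℝ) : ∃ i, r ∈ winSet lam i := by
  obtain ⟨i, hi⟩ := Finite.exists_min fun k => lam k - r k
  exact ⟨i, hi⟩

theorem winProb_nonneg (lam : Fin K → ℝ) (i : Fin K) : 0 ≤ winProb α lam i := measureReal_nonneg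

variable [hα : Fact (1 < α)]

instance isProbabilityMeasure_paretoMeasure_one : IsProbabilityMeasure (paretoMeasure 1 α) :=
  isProbabilityMeasure_paretoMeasure one_pos (one_pos.trans hα.out)

theorem paretoPi_eval (k : Fin K) {S : Set ℝ} (hS : MeasurableSet S) :
    paretoPi K α {r | r k ∈ S} = paretoMeasure 1 α S :=
  (measurePreserving_eval (fun _ : Fin K => paretoMeasure 1 α) k).measure_preimage
    hS.nullMeasurableSet

theorem ae_one_le_paretoPi : ∀ᵐ r ∂(paretoPi K α), ∀ k, 1 ≤ r k := by
  rw [ae_all_iff]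
  intro k
  exact (measurePreserving_eval (fun _ : Fin K => paretoMeasure 1 α) k).quasiMeasurePreserving.ae
    ae_one_le_paretoMeasure

theorem ae_ne_paretoPi (lam : Fin K → ℝ) :
    ∀ᵐ r ∂(paretoPi K α), ∀ i k, i ≠ k → lam i - r i ≠ lam k - r k := by
  rw [ae_all_iff]; intro i
  rw [ae_all_iff]; intro k
  by_cases hik : i = k
  · exact ae_of_all _ fun r h => absurd hik h
  have hA : MeasurableSet {r : Fin K → ℝ | lam i - r i = lam k - r k} :=
    measurableSet_eq_fun (by fun_prop) (by fun_prop)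
  have h0 : paretoPi K α {r : Fin K → ℝ | lam i - r i = lam k - r k} ≤ ∫⁻ _, 0 ∂(paretoPi K α) := by
    refine measure_pi_le_of_update hA i (ae_of_all _ fun r => ?_)
    have : {y | Function.update r i y ∈ {r : Fin K → ℝ | lam i - r i = lam k - r k}}
        ⊆ {lam i - (lam k - r k)} := by
      intro y hy
      simp only [Set.mem_ofPred_eq, Function.update_self,
        Function.update_of_ne (Ne.symm hik)] at hy
      simp only [Set.mem_singleton_iff]; linarith
    exact (measure_mono this).trans (by simp)
  simp only [lintegral_zero, nonpos_iff_eq_zero] at h0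
  rw [ae_iff]
  refine measure_mono_null (fun r hr => ?_) h0
  simpa [hik] using hr

theorem ae_sum_indicator_winSet (lam : Fin K → ℝ) :
    ∀ᵐ r ∂(paretoPi K α), ∀ i, r ∈ winSet lam i → ∀ h : Fin K → ℝ,
      ∑ k, (winSet lam k).indicator (fun _ => h k) r = h i := by
  filter_upwards [ae_ne_paretoPi lam] with r hr i hi h
  rw [Finset.sum_eq_single i]
  · exact Set.indicator_of_mem hi _
  · intro k _ hk
    refine Set.indicator_of_notMem (fun hk' : r ∈ winSet lam k => ?_) _
    exact hr i k hk.symm (le_antisymm (hi k) (hk' i))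
  · simp

theorem winProb_le_one (lam : Fin K → ℝ) (i : Fin K) : winProb α lam i ≤ 1 := measureReal_le_one

theorem sum_winProb [Nonempty (Fin K)] (lam : Fin K → ℝ) : ∑ i, winProb α lam i = 1 := by
  have h1 : ∀ i, winProb α lam i
      = ∫ r, (winSet lam i).indicator (fun _ => (1 : ℝ)) r ∂(paretoPi K α) := fun i => by
    rw [integral_indicator_const _ (measurableSet_winSet lam i)]; simp [winProb]
  simp_rw [h1]
  rw [← integral_finsetSum]
  · rw [integral_congr_ae (g := fun _ => 1)]
    · simp
    · filter_upwards [ae_sum_indicator_winSet lam] with r hr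
      obtain ⟨i, hi⟩ := exists_mem_winSet lam r
      exact hr i hi fun _ => 1
  · exact fun i _ => (integrable_const _).indicator (measurableSet_winSet lam i)

theorem measurable_winProb (i : Fin K) : Measurable fun lam : Fin K → ℝ => winProb α lam i := by
  have hS : MeasurableSet {x : (Fin K → ℝ) × (Fin K → ℝ) | x.2 ∈ winSet x.1 i} := by
    have : {x : (Fin K → ℝ) × (Fin K → ℝ) | x.2 ∈ winSet x.1 i}
        = ⋂ k, {x | x.1 i - x.2 i ≤ x.1 k - x.2 k} := by
      ext x; simp [winSet]
    rw [this]
    exact MeasurableSet.iInter fun k => measurableSet_le (by fun_prop) (by fun_prop)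
  exact (measurable_measure_prodMk_left hS).ennreal_toReal

theorem integrable_eval_paretoPi (i : Fin K) : Integrable (fun r => r i) (paretoPi K α) :=
  (measurePreserving_eval (fun _ : Fin K => paretoMeasure 1 α) i).integrable_comp_of_integrable
    (integrable_id_paretoMeasure hα.out)

/-- The worst event of probability `w` is an upper tail of `r i`. Splitting at the level `B` of tail
probability `w`, the parts below and above `B` are both multiples of `w ^ (1 - 1/α)`. -/
theorem setIntegral_eval_paretoPi_le (i : Fin K) (A : Set (Fin K → ℝ)) :
    ∫ r in A, r i ∂(paretoPi K α)
      ≤ (1 + α / (α - 1)) * (paretoPi K α).real A ^ (1 - 1 / α) := by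
  have hα1 : 1 < α := hα.out
  have hα0 : 0 < α := by linarith
  set w := (paretoPi K α).real A with hw
  have hexp : 0 < 1 - 1 / α := by rw [sub_pos, div_lt_one hα0]; exact hα1
  rcases (measureReal_nonneg (μ := paretoPi K α) (s := A)).eq_or_lt with h0 | h0
  · have h0' : paretoPi K α A = 0 := by
      rw [measureReal_def, eq_comm, ENNReal.toReal_eq_zero_iff] at h0
      exact h0.resolve_right (measure_ne_top _ _)
    rw [setIntegral_measure_zero _ h0', hw, ← h0, Real.zero_rpow hexp.ne', mul_zero]
  have hw1 : w ≤ 1 := measureReal_le_one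
  set B := w ^ (-(1 / α)) with hB
  have hB1 : 1 ≤ B := Real.one_le_rpow_of_pos_of_le_one_of_nonpos h0 hw1
    (by rw [neg_nonpos]; positivity)
  have htail : Integrable (fun r : Fin K → ℝ => (Set.Ioi B).indicator (fun x : ℝ => x) (r i))
      (paretoPi K α) :=
    (measurePreserving_eval (fun _ : Fin K => paretoMeasure 1 α) i).integrable_comp_of_integrable
      ((integrable_id_paretoMeasure hα1).indicator measurableSet_Ioi)
  have hpos : ∀ r : Fin K → ℝ, 0 ≤ (Set.Ioi B).indicator (fun x : ℝ => x) (r i) := fun r =>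
    Set.indicator_nonneg (fun x hx => (by linarith : (0 : ℝ) ≤ B).trans (le_of_lt hx)) _
  have htail_val : ∫ r, (Set.Ioi B).indicator (fun x : ℝ => x) (r i) ∂(paretoPi K α)
      = α / (α - 1) * B ^ (1 - α) := by
    rw [← setIntegral_id_paretoMeasure_Ioi hα1 hB1, ← integral_indicator measurableSet_Ioi,
      ← (measurePreserving_eval (fun _ : Fin K => paretoMeasure 1 α) i).map_eq,
      integral_map (measurable_pi_apply i).aemeasurable]
    exact (measurable_id.indicator measurableSet_Ioi).aestronglyMeasurable
  calc ∫ r in A, r i ∂(paretoPi K α)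
      ≤ ∫ r in A, (B + (Set.Ioi B).indicator (fun x : ℝ => x) (r i)) ∂(paretoPi K α) := by
        refine integral_mono (integrable_eval_paretoPi i).integrableOn
          ((integrable_const B).add htail).integrableOn fun r => ?_
        by_cases h : B < r i
        · simp [Set.indicator, h]; linarith
        · simp [Set.indicator, h]; linarith
    _ = B * w + ∫ r in A, (Set.Ioi B).indicator (fun x : ℝ => x) (r i) ∂(paretoPi K α) := by
        rw [integral_add (integrable_const B) htail.integrableOn]
        simp [hw, mul_comm]
    _ ≤ B * w + α / (α - 1) * B ^ (1 - α) := by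
        rw [← htail_val]
        gcongr
        · exact ae_of_all _ hpos
        · exact Measure.restrict_le_self
    _ = (1 + α / (α - 1)) * w ^ (1 - 1 / α) := by
        have e1 : B * w = w ^ (1 - 1 / α) := by
          rw [hB]; nth_rewrite 2 [← Real.rpow_one w]
          rw [← Real.rpow_add h0]; congr 1; ring
        have e2 : B ^ (1 - α) = w ^ (1 - 1 / α) := by
          rw [hB, ← Real.rpow_mul h0.le]; congr 1; field_simp; ring
        rw [e1, e2]; ring

end Win

/-! ### Decrease of a winning probability when the loss of its arm grows -/

section WinDifference

variable {K : ℕ} {α : ℝ} [hα : Fact (1 < α)]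

theorem winProb_sub_le (lam lam' : Fin K → ℝ) (i : Fin K) :
    winProb α lam i - winProb α lam' i
      ≤ (paretoPi K α (winSet lam i \ winSet lam' i)).toReal := by
  have := le_measureReal_sdiff (μ := paretoPi K α) (s₁ := winSet lam i) (s₂ := winSet lam' i)
  exact this

theorem winProb_anti (lam : Fin K → ℝ) (i : Fin K) {x y : ℝ} (hxy : x ≤ y) :
    winProb α (lam + Pi.single i y) i ≤ winProb α (lam + Pi.single i x) i := by
  refine measureReal_mono (fun r (hr : ∀ k, _) k => ?_) (measure_ne_top _ _)
  have := hr k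
  by_cases hk : k = i
  · subst hk; exact le_rfl
  · simp only [Pi.add_apply, Pi.single_eq_same, Pi.single_eq_of_ne hk] at this ⊢
    linarith

/-- With the other coordinates fixed, arm `i` wins iff `r i` reaches the threshold `m`, the maximum
over `k ≠ i` of `lam i - lam k + r k`. The shift by `x` moves this threshold to `m + x`, so the win
is lost only for `r i` between the two. -/
theorem section_winSet_diff_subset [Nontrivial (Fin K)] (lam r : Fin K → ℝ) (i : Fin K) (x : ℝ) :
    ∃ m k, k ≠ i ∧ m = lam i - lam k + r k ∧ (∀ k, k ≠ i → lam i - lam k + r k ≤ m) ∧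
      {y | Function.update r i y ∈ winSet lam i \ winSet (lam + Pi.single i x) i}
        ⊆ Set.Ico m (m + x) := by
  obtain ⟨k₀, hk₀⟩ := exists_ne i
  obtain ⟨k, hk, hmax⟩ := Finset.exists_max_image (Finset.univ.erase i)
    (fun k => lam i - lam k + r k) ⟨k₀, by simp [hk₀]⟩
  have hki : k ≠ i := (Finset.mem_erase.1 hk).1
  refine ⟨lam i - lam k + r k, k, hki, rfl, fun j hj => hmax j (by simp [hj]), ?_⟩
  rintro y ⟨hy1 : ∀ k, _, hy2⟩
  have h1 := hy1 k
  simp only [Function.update_self, Function.update_of_ne hki] at h1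
  refine ⟨by linarith, ?_⟩
  by_contra! hcon
  refine hy2 fun j => ?_
  by_cases hj : j = i
  · subst hj; exact le_rfl
  · have h2 := hmax j (by simp [hj])
    simp only [Function.update_self, Function.update_of_ne hj, Pi.add_apply, Pi.single_eq_same,
      Pi.single_eq_of_ne hj] at h2 ⊢
    linarith

/-- Here `b` is any lower bound, at least `1`, for the random threshold `m` or for the left end `1`
of the support. The three estimates of a decrease differ in how the threshold is handled; this lemma
serves the first two. -/
theorem measure_winSet_diff_le [Nontrivial (Fin K)] (lam : Fin K → ℝ) (i : Fin K) (x : ℝ)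
    {b : (Fin K → ℝ) → ℝ} (hb1 : ∀ᵐ r ∂(paretoPi K α), 1 ≤ b r)
    (hb : ∀ᵐ r ∂(paretoPi K α), b r ≤ 1 ∨ ∃ k, k ≠ i ∧ b r ≤ lam i - lam k + r k) :
    paretoPi K α (winSet lam i \ winSet (lam + Pi.single i x) i)
      ≤ ∫⁻ r, ENNReal.ofReal (α * x * b r ^ (-(α + 1))) ∂(paretoPi K α) := by
  have hα1 : 1 < α := hα.out
  refine measure_pi_le_of_update ((measurableSet_winSet _ _).diff (measurableSet_winSet _ _)) i ?_
  filter_upwards [hb1, hb] with r hr1 hr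
  obtain ⟨m, k, -, -, hm, hsub⟩ := section_winSet_diff_subset lam r i x
  refine (measure_mono hsub).trans (paretoMeasure_Ico_le (by linarith) hr1 ?_)
  rcases hr with h | ⟨j, hj, h⟩
  · exact h.trans (le_max_left _ _)
  · exact (h.trans (hm j hj)).trans (le_max_right _ _)

/-- Every perturbation is at least `1`, so an arm `k` that is ahead of `i` by `g` forces the
threshold above `1 + g`. -/
theorem winProb_sub_le_of_gap [Nontrivial (Fin K)] (lam : Fin K → ℝ) (i : Fin K) {x g : ℝ}
    (hx : 0 ≤ x) (hg : 0 ≤ g) (hlam : g = 0 ∨ ∃ k, k ≠ i ∧ g ≤ lam i - lam k) :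
    winProb α lam i - winProb α (lam + Pi.single i x) i ≤ α * x * (1 + g) ^ (-(α + 1)) := by
  have hα1 : 1 < α := hα.out
  have h := measure_winSet_diff_le (α := α) lam i x (b := fun _ => 1 + g)
    (ae_of_all _ fun _ => by linarith) (by
      filter_upwards [ae_one_le_paretoPi] with r hr
      rcases hlam with h | ⟨k, hk, h⟩
      · left; linarith
      · right; exact ⟨k, hk, by linarith [hr k]⟩)
  rw [lintegral_const, measure_univ, mul_one] at h
  refine (winProb_sub_le _ _ _).trans (ENNReal.toReal_le_of_le_ofReal ?_ h)
  have := Real.rpow_nonneg (by linarith : 0 ≤ 1 + g) (-(α + 1))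
  have : 0 ≤ α := by linarith
  positivity

theorem paretoMeasure_Iic_le (y : ℝ) {t : ℝ} (ht0 : 0 < t) (ht1 : t < 1) (hy : y = t ^ (-(1 / α))) :
    paretoMeasure 1 α (Set.Iic y) ≤ ENNReal.ofReal (Real.exp (-t)) := by
  have hα1 : 1 < α := hα.out
  have hα0 : 0 < α := by linarith
  have hy1 : 1 ≤ y := hy ▸ Real.one_le_rpow_of_pos_of_le_one_of_nonpos ht0 ht1.le
    (by rw [neg_nonpos]; positivity)
  have hyt : y ^ (-α) = t := by
    rw [hy, ← Real.rpow_mul ht0.le]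
    rw [show -(1 / α) * -α = 1 by field_simp, Real.rpow_one]
  rw [show Set.Iic y = (Set.Ioi y)ᶜ by simp, prob_compl_eq_one_sub measurableSet_Ioi,
    paretoMeasure_Ioi hα0 hy1, hyt, ← ENNReal.ofReal_one, ← ENNReal.ofReal_sub _ ht0.le]
  refine ENNReal.ofReal_le_ofReal ?_
  have := Real.add_one_le_exp (-t)
  linarith

/-- For a maximum `Z` of `n` Pareto variables, `Z ^ (-α)` is a minimum of `n` uniform variables, so
it exceeds `t` with probability at most `exp (-n t)`. The layer-cake formula for the power `β = 1 +
1/α` of `Z ^ (-α)` then gives a Gamma integral of order `n ^ (-β)`. -/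
theorem lintegral_max_rpow_le (J : Finset (Fin K)) (hJ : J.Nonempty) :
    ∫⁻ r, ENNReal.ofReal ((max 1 (J.sup' hJ fun j => r j)) ^ (-(α + 1))) ∂(paretoPi K α)
      ≤ ENNReal.ofReal ((1 + 1 / α) * Real.Gamma (1 + 1 / α) * (J.card : ℝ) ^ (-(1 + 1 / α))) := by
  have hα1 : 1 < α := hα.out
  have hα0 : 0 < α := by linarith
  set β := 1 + 1 / α with hβ
  have hβ0 : 0 < β := by positivity
  set Z : (Fin K → ℝ) → ℝ := fun r => max 1 (J.sup' hJ fun j => r j) with hZ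
  have hZm : Measurable Z := by
    refine measurable_const.max ?_
    have : Measurable (J.sup' hJ fun j (r : Fin K → ℝ) => r j) :=
      Finset.measurable_sup' hJ fun j _ => measurable_pi_apply j
    convert this using 1
    ext r
    simp [Finset.sup'_apply]
  have hZ1 : ∀ r, 1 ≤ Z r := fun r => le_max_left _ _
  have hn : 0 < (J.card : ℝ) := by exact_mod_cast hJ.card_pos
  have e1 : ∀ r, Z r ^ (-(α + 1)) = (Z r ^ (-α)) ^ β := fun r => by
    rw [← Real.rpow_mul (by linarith [hZ1 r])]; congr 1; rw [hβ]; field_simp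
  have hmeas : ∀ t ∈ Set.Ioi (0 : ℝ), paretoPi K α {r | t < Z r ^ (-α)} * ENNReal.ofReal (t ^ (β - 1))
      ≤ ENNReal.ofReal (t ^ (β - 1) * Real.exp (-(J.card * t))) := by
    intro t ht
    have ht : 0 < t := ht
    have htp := Real.rpow_nonneg ht.le (β - 1)
    rw [mul_comm, ENNReal.ofReal_mul htp]
    gcongr
    rcases lt_or_ge t 1 with h1 | h1
    · have hsub : {r | t < Z r ^ (-α)} ⊆ Set.pi Set.univ
          fun j => if j ∈ J then Set.Iic (t ^ (-(1 / α))) else Set.univ := by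
        intro r (hr : t < Z r ^ (-α)) j _
        show r j ∈ if j ∈ J then Set.Iic (t ^ (-(1 / α))) else Set.univ
        by_cases hj : j ∈ J
        · rw [if_pos hj]
          have hrZ : r j ≤ Z r := (Finset.le_sup' (fun j => r j) hj).trans (le_max_right _ _)
          refine hrZ.trans ?_
          have := Real.rpow_le_rpow_of_nonpos ht hr.le (z := -(1 / α))
            (by rw [neg_nonpos]; positivity)
          rwa [← Real.rpow_mul (by linarith [hZ1 r]), show -α * -(1 / α) = 1 by field_simp,
            Real.rpow_one] at this
        · rw [if_neg hj]; trivial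
      refine (measure_mono hsub).trans ?_
      rw [Measure.pi_pi]
      calc ∏ j, paretoMeasure 1 α (if j ∈ J then Set.Iic (t ^ (-(1 / α))) else Set.univ)
          ≤ ∏ j, (if j ∈ J then ENNReal.ofReal (Real.exp (-t)) else 1) := by
            refine Finset.prod_le_prod' fun j _ => ?_
            split_ifs
            · exact paretoMeasure_Iic_le _ ht h1 rfl
            · simp
        _ = ENNReal.ofReal (Real.exp (-(J.card * t))) := by
            rw [Finset.prod_ite_mem, Finset.univ_inter, Finset.prod_const,
              ← ENNReal.ofReal_pow (Real.exp_nonneg _), ← Real.exp_nat_mul]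
            congr 2; ring
    · have : {r | t < Z r ^ (-α)} = ∅ := by
        ext r
        simp only [Set.mem_ofPred_eq, Set.mem_empty_iff_false, iff_false, not_lt]
        exact (Real.rpow_le_one_of_one_le_of_nonpos (hZ1 r) (by linarith)).trans h1
      rw [this]; simp
  have hint := Real.integral_rpow_mul_exp_neg_mul_Ioi hβ0 hn
  have hΓ := Real.Gamma_pos_of_pos hβ0
  have hintble : IntegrableOn (fun t : ℝ => t ^ (β - 1) * Real.exp (-(J.card * t))) (Set.Ioi 0) := by
    refine Integrable.of_integral_ne_zero ?_
    rw [hint]; positivity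
  change ∫⁻ r, ENNReal.ofReal (Z r ^ (-(α + 1))) ∂(paretoPi K α) ≤ _
  simp_rw [e1]
  rw [lintegral_rpow_eq_lintegral_meas_lt_mul _
    (ae_of_all _ fun r => Real.rpow_nonneg (by linarith [hZ1 r]) _)
    (hZm.pow_const _).aemeasurable hβ0]
  refine (mul_le_mul_right (setLIntegral_mono' measurableSet_Ioi hmeas) _).trans ?_
  rw [← ofReal_integral_eq_lintegral_ofReal hintble, hint, ← ENNReal.ofReal_mul hβ0.le]
  · refine ENNReal.ofReal_le_ofReal (le_of_eq ?_)
    rw [one_div, Real.inv_rpow hn.le, Real.rpow_neg hn.le]; ring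
  · filter_upwards [ae_restrict_mem measurableSet_Ioi] with t ht
    exact mul_nonneg (Real.rpow_nonneg (le_of_lt ht) _) (Real.exp_nonneg _)

/-- Arms that are no worse than `i` push its threshold up to the maximum of their perturbations,
which is typically of size `J.card ^ (1/α)`. -/
theorem winProb_sub_le_of_card [Nontrivial (Fin K)] (lam : Fin K → ℝ) (i : Fin K) {x : ℝ}
    (hx : 0 ≤ x) (J : Finset (Fin K)) (hJ : J.Nonempty) (hlam : ∀ j ∈ J, j ≠ i ∧ lam j ≤ lam i) :
    winProb α lam i - winProb α (lam + Pi.single i x) i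
      ≤ α * x * ((1 + 1 / α) * Real.Gamma (1 + 1 / α) * (J.card : ℝ) ^ (-(1 + 1 / α))) := by
  have hα1 : 1 < α := hα.out
  have h := measure_winSet_diff_le (α := α) lam i x (b := fun r => max 1 (J.sup' hJ fun j => r j))
    (ae_of_all _ fun _ => le_max_left _ _) (ae_of_all _ fun r => by
      rcases le_total (J.sup' hJ fun j => r j) 1 with h | h
      · left; simp only [max_le_iff]; exact ⟨le_rfl, h⟩
      · right
        obtain ⟨j, hj, hj'⟩ := Finset.exists_mem_eq_sup' hJ fun j => r j
        refine ⟨j, (hlam j hj).1, ?_⟩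
        rw [max_eq_right h, hj']
        linarith [(hlam j hj).2])
  have hαx : 0 ≤ α * x := mul_nonneg (by linarith) hx
  simp_rw [ENNReal.ofReal_mul hαx] at h
  rw [lintegral_const_mul' _ _ ENNReal.ofReal_ne_top] at h
  replace h := h.trans (mul_le_mul_right (lintegral_max_rpow_le J hJ) _)
  rw [← ENNReal.ofReal_mul hαx] at h
  refine (winProb_sub_le _ _ _).trans (ENNReal.toReal_le_of_le_ofReal ?_ h)
  have hβ0 : 0 < 1 + 1 / α := by positivity
  have hΓ := Real.Gamma_pos_of_pos hβ0
  positivity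

theorem paretoMeasure_Ioi_le {y z : ℝ} (hz : 0 < z) (hzy : z ≤ max 1 y) :
    paretoMeasure 1 α (Set.Ioi y) ≤ ENNReal.ofReal (z ^ (-α)) := by
  have hα1 : 1 < α := hα.out
  rcases le_total y 1 with h | h
  · rw [max_eq_left h] at hzy
    refine prob_le_one.trans ?_
    rw [← ENNReal.ofReal_one]
    exact ENNReal.ofReal_le_ofReal
      (Real.one_le_rpow_of_pos_of_le_one_of_nonpos hz hzy (by linarith))
  · rw [max_eq_right h] at hzy
    rw [paretoMeasure_Ioi (by linarith) h]
    exact ENNReal.ofReal_le_ofReal (Real.rpow_le_rpow_of_nonpos hz hzy (by linarith))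

/-- A leader has no gap, so the smallness comes from elsewhere. A window of length at most `1/2`
meets the support `[1, ∞)` only if its left end exceeds `1/2`, that is, if some rival has `r k > 1/2
+ (lam k - lam i)`. A union bound over the rivals gives the sum. -/
theorem winProb_sub_le_of_leader [Nontrivial (Fin K)] (lam : Fin K → ℝ) (i : Fin K) {x : ℝ}
    (hx : 0 ≤ x) (hx2 : x ≤ 1 / 2) (hlam : ∀ k, lam i ≤ lam k) :
    winProb α lam i - winProb α (lam + Pi.single i x) i
      ≤ α * x * (2 ^ α * ∑ k ∈ Finset.univ.erase i, (1 + (lam k - lam i)) ^ (-α)) := by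
  have hα1 : 1 < α := hα.out
  have hαx : 0 ≤ α * x := mul_nonneg (by linarith) hx
  set E : Fin K → Set (Fin K → ℝ) := fun k => {r | r k ∈ Set.Ioi (1 / 2 + (lam k - lam i))} with hE
  have hEm : ∀ k, MeasurableSet (E k) := fun k => measurable_pi_apply k measurableSet_Ioi
  set U : Set (Fin K → ℝ) := ⋃ k ∈ Finset.univ.erase i, E k with hU
  have hUm : MeasurableSet U := Finset.measurableSet_biUnion _ fun k _ => hEm k
  have h1 : paretoPi K α (winSet lam i \ winSet (lam + Pi.single i x) i)
      ≤ ∫⁻ r, U.indicator (fun _ => ENNReal.ofReal (α * x)) r ∂(paretoPi K α) := by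
    refine measure_pi_le_of_update ((measurableSet_winSet _ _).diff (measurableSet_winSet _ _)) i ?_
    refine ae_of_all _ fun r => ?_
    obtain ⟨m, k, hk, hmk, -, hsub⟩ := section_winSet_diff_subset lam r i x
    refine (measure_mono hsub).trans ?_
    rcases le_or_gt (m + x) 1 with h | h
    · have : Set.Ico m (m + x) ⊆ Set.Iio 1 := fun y hy => lt_of_lt_of_le hy.2 h
      exact (measure_mono this).trans (by rw [paretoMeasure_Iio_one]; exact zero_le)
    · have hr : r ∈ U := by
        simp only [hU, Set.mem_iUnion]
        refine ⟨k, by simp [hk], ?_⟩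
        show 1 / 2 + (lam k - lam i) < r k
        linarith
      rw [Set.indicator_of_mem hr]
      have := paretoMeasure_Ico_le (α := α) (by linarith) (b := 1) (m := m) (x := x) le_rfl
        (le_max_left _ _)
      simpa using this
  rw [lintegral_indicator_const hUm] at h1
  have h2 : paretoPi K α U ≤ ENNReal.ofReal
      (2 ^ α * ∑ k ∈ Finset.univ.erase i, (1 + (lam k - lam i)) ^ (-α)) := by
    refine (measure_biUnion_finset_le _ _).trans ?_
    have hnn : ∀ k ∈ Finset.univ.erase i, 0 ≤ 2 ^ α * (1 + (lam k - lam i)) ^ (-α) := fun k _ =>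
      mul_nonneg (by positivity) (Real.rpow_nonneg (by linarith [hlam k]) _)
    rw [Finset.mul_sum, ENNReal.ofReal_sum_of_nonneg hnn]
    refine Finset.sum_le_sum fun k _ => ?_
    have hg := hlam k
    rw [hE, paretoPi_eval k measurableSet_Ioi]
    -- For gaps up to `1` the level `(1 + gap) / 2` is at most `1`, and beyond that it is at most
    -- `1/2 + gap`. Halving `1 + gap` is what costs the factor `2 ^ α`.
    refine (paretoMeasure_Ioi_le (z := (1 + (lam k - lam i)) / 2) (by linarith) ?_).trans ?_
    · rcases le_total (lam k - lam i) 1 with h | h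
      · exact le_max_of_le_left (by linarith)
      · exact le_max_of_le_right (by linarith)
    · refine ENNReal.ofReal_le_ofReal (le_of_eq ?_)
      rw [Real.div_rpow (by linarith) (by norm_num), Real.rpow_neg (by norm_num : (0 : ℝ) ≤ 2)]
      field_simp
  refine (winProb_sub_le _ _ _).trans (ENNReal.toReal_le_of_le_ofReal ?_ ?_)
  · refine mul_nonneg hαx (mul_nonneg (by positivity) (Finset.sum_nonneg fun k _ => ?_))
    exact Real.rpow_nonneg (by linarith [hlam k]) _
  · rw [ENNReal.ofReal_mul hαx]
    exact h1.trans (mul_le_mul_right h2 _)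

end WinDifference

/-! ### A likely winner leads the estimates, with controlled gaps -/

section Leader

variable {K : ℕ} {α : ℝ} [hα : Fact (1 < α)]

/-- Arm `i` loses whenever `r i ≤ 2` and some rival has `r j > 2 + (lam j - lam i)`. These two
events are independent, and the first has probability `1 - 2 ^ (-α) ≥ 1/2`. -/
theorem half_mul_one_sub_prod_le_one_sub_winProb (lam : Fin K → ℝ) (i : Fin K) :
    1 / 2 * (1 - ∏ j ∈ Finset.univ.erase i,
      (1 - (paretoMeasure 1 α).real (Set.Ioi (2 + (lam j - lam i))))) ≤ 1 - winProb α lam i := by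
  have hα1 : 1 < α := hα.out
  set ν := paretoMeasure 1 α with hν
  have hcompl : ∀ y, ν.real (Set.Iic y) = 1 - ν.real (Set.Ioi y) := fun y => by
    rw [← Set.compl_Ioi, probReal_compl_eq_one_sub measurableSet_Ioi]
  set Q : Set (Fin K → ℝ) := Set.pi Set.univ
    fun j => if j = i then Set.Iic 2 else Set.Iic (2 + (lam j - lam i)) with hQ
  set R : Set (Fin K → ℝ) := {r | r i ∈ Set.Iic 2} with hR
  have hQm : MeasurableSet Q := MeasurableSet.univ_pi fun j => by
    split_ifs <;> exact measurableSet_Iic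
  have hQR : Q ⊆ R := fun r hr => by
    have := hr i trivial
    show r i ≤ 2
    simpa using this
  have hsub : R \ Q ⊆ (winSet lam i)ᶜ := by
    rintro r ⟨hr2 : r i ≤ 2, hrQ⟩ (hr : ∀ k, _)
    refine hrQ fun j _ => ?_
    have := hr j
    show r j ∈ if j = i then Set.Iic 2 else Set.Iic (2 + (lam j - lam i))
    split_ifs with h
    · subst h; exact hr2
    · simp only [Set.mem_Iic]; linarith
  have h1 : (paretoPi K α).real (R \ Q) ≤ 1 - winProb α lam i := by
    rw [winProb, ← probReal_compl_eq_one_sub (measurableSet_winSet lam i)]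
    exact measureReal_mono hsub
  rw [measureReal_sdiff hQR hQm] at h1
  have hRv : (paretoPi K α).real R = ν.real (Set.Iic 2) := by
    rw [measureReal_def, hR, paretoPi_eval i measurableSet_Iic, measureReal_def]
  have hQv : (paretoPi K α).real Q = ν.real (Set.Iic 2) *
      ∏ j ∈ Finset.univ.erase i, (1 - ν.real (Set.Ioi (2 + (lam j - lam i)))) := by
    rw [measureReal_def, hQ, Measure.pi_pi, ENNReal.toReal_prod,
      ← Finset.mul_prod_erase _ _ (Finset.mem_univ i), if_pos rfl]
    congr 1
    refine Finset.prod_congr rfl fun j hj => ?_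
    rw [if_neg (Finset.ne_of_mem_erase hj), ← hcompl]; rfl
  rw [hRv, hQv] at h1
  have hhalf : 1 / 2 ≤ ν.real (Set.Iic 2) := by
    rw [hcompl, hν, paretoMeasure_real_Ioi (by linarith) (by norm_num)]
    have : (2 : ℝ) ^ (-α) ≤ 2 ^ (-1 : ℝ) :=
      Real.rpow_le_rpow_of_exponent_le (by norm_num) (by linarith)
    rw [Real.rpow_neg_one] at this
    linarith
  have hprod : ∏ j ∈ Finset.univ.erase i, (1 - ν.real (Set.Ioi (2 + (lam j - lam i)))) ≤ 1 :=
    Finset.prod_le_one (fun j _ => sub_nonneg.2 measureReal_le_one)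
      fun j _ => sub_le_self _ measureReal_nonneg
  nlinarith

/-- A rival that is not behind `i` would exceed the level of the preceding lemma with probability at
least `2 ^ (-α) ≥ 1/8`, hence beat `i` with probability at least `1/16`; this is the origin of the
threshold. When `i` leads, the probability of losing is comparable to the sum of the rivals' tail
probabilities. -/
theorem leader_of_one_sub_winProb_lt (hα3 : α ≤ 3) (lam : Fin K → ℝ) (i : Fin K)
    (hW : 1 - winProb α lam i < 1 / 16) :
    (∀ j, j ≠ i → lam i < lam j) ∧
      ∑ j ∈ Finset.univ.erase i, (1 + (lam j - lam i)) ^ (-α) ≤ 24 * (1 - winProb α lam i) := by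
  have hα1 : 1 < α := hα.out
  have hα0 : 0 < α := by linarith
  have hkey := half_mul_one_sub_prod_le_one_sub_winProb (α := α) lam i
  set b : Fin K → ℝ := fun j => (paretoMeasure 1 α).real (Set.Ioi (2 + (lam j - lam i))) with hb
  have hb0 : ∀ j, 0 ≤ b j := fun j => measureReal_nonneg
  have hb1 : ∀ j, b j ≤ 1 := fun j => measureReal_le_one
  have h8 : (1 : ℝ) / 8 ≤ 2 ^ (-α) := by
    have : (2 : ℝ) ^ (-3 : ℝ) ≤ 2 ^ (-α) :=
      Real.rpow_le_rpow_of_exponent_le (by norm_num) (by linarith)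
    refine le_trans (le_of_eq ?_) this
    rw [Real.rpow_neg (by norm_num)]; norm_num
  have hlt : ∀ j, j ≠ i → lam i < lam j := by
    intro j hj
    by_contra! hle
    have h1 : 1 / 8 ≤ b j := by
      refine h8.trans ?_
      rw [← paretoMeasure_real_Ioi hα0 one_le_two]
      exact measureReal_mono (Set.Ioi_subset_Ioi (by linarith))
    have h2 : ∏ k ∈ Finset.univ.erase i, (1 - b k) ≤ 1 - b j := by
      rw [← Finset.mul_prod_erase _ _ (Finset.mem_erase.2 ⟨hj, Finset.mem_univ j⟩)]
      refine mul_le_of_le_one_right (by linarith [hb1 j]) (Finset.prod_le_one ?_ ?_)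
      · exact fun k _ => by linarith [hb1 k]
      · exact fun k _ => by linarith [hb0 k]
    change 1 / 2 * (1 - ∏ k ∈ Finset.univ.erase i, (1 - b k)) ≤ _ at hkey
    linarith
  refine ⟨hlt, ?_⟩
  set y := ∑ j ∈ Finset.univ.erase i, b j with hy
  have hy0 : 0 ≤ y := Finset.sum_nonneg fun j _ => hb0 j
  have hsum : ∑ j ∈ Finset.univ.erase i, (1 + (lam j - lam i)) ^ (-α) ≤ 8 * y := by
    rw [hy, Finset.mul_sum]
    refine Finset.sum_le_sum fun j hj => ?_
    have hg := hlt j (Finset.ne_of_mem_erase hj)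
    simp only [hb]
    rw [paretoMeasure_real_Ioi hα0 (by linarith)]
    have h1 : (2 * (1 + (lam j - lam i))) ^ (-α) ≤ (2 + (lam j - lam i)) ^ (-α) :=
      Real.rpow_le_rpow_of_nonpos (by linarith) (by linarith) (by linarith)
    rw [Real.mul_rpow (by norm_num) (by linarith)] at h1
    have h2 : 0 ≤ (1 + (lam j - lam i)) ^ (-α) := Real.rpow_nonneg (by linarith) _
    nlinarith
  -- Turns the product into the sum `y`: `(1 - 2 W) (1 + y) ≤ 1` with `W < 1/16` gives `y ≤ 16 W /
  -- 7`, and `8 y ≤ 24 W` follows with room to spare.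
  have hprod : ∏ j ∈ Finset.univ.erase i, (1 - b j) ≤ (1 + y)⁻¹ := by
    calc ∏ j ∈ Finset.univ.erase i, (1 - b j)
        ≤ ∏ j ∈ Finset.univ.erase i, Real.exp (-b j) := by
          refine Finset.prod_le_prod (fun j _ => by linarith [hb1 j]) fun j _ => ?_
          linarith [Real.add_one_le_exp (-b j)]
      _ = (Real.exp y)⁻¹ := by
          rw [← Real.exp_sum, Finset.sum_neg_distrib, Real.exp_neg]
      _ ≤ (1 + y)⁻¹ := by
          have := Real.add_one_le_exp y
          gcongr; linarith
  have h3 : 1 - 2 * (1 - winProb α lam i) ≤ (1 + y)⁻¹ := by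
    change 1 / 2 * (1 - ∏ k ∈ Finset.univ.erase i, (1 - b k)) ≤ _ at hkey
    linarith
  rw [le_inv_comm₀ (by linarith) (by linarith), le_inv_comm₀ (by linarith) (by linarith)] at h3
  have h4 : (1 - 2 * (1 - winProb α lam i)) * (1 + y) ≤ 1 := by
    rw [← le_div_iff₀ (by linarith), one_div]; exact h3
  have hW0 : 0 ≤ 1 - winProb α lam i := by linarith [winProb_le_one (α := α) lam i]
  nlinarith

end Leader

/-! ### Rankings -/

section Ranking

variable {K : ℕ} {L : Fin K → ℝ} {σ : Fin K → ℕ}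

theorem IsRanking.one_le (h : IsRanking L σ) (i : Fin K) : 1 ≤ σ i :=
  (h.1.mapsTo (Set.mem_univ i)).1

theorem IsRanking.le_of_lt (h : IsRanking L σ) {i j : Fin K} (hij : σ j < σ i) :
    j ≠ i ∧ L j ≤ L i := by
  refine ⟨fun e => by subst e; exact lt_irrefl _ hij, ?_⟩
  by_contra! hlt
  exact (h.2 i j hlt).not_gt hij

theorem IsRanking.image_univ (h : IsRanking L σ) : Finset.univ.image σ = Finset.Icc 1 K := by
  apply Finset.coe_injective
  simpa using h.1.image_eq

theorem IsRanking.injective (h : IsRanking L σ) : Function.Injective σ :=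
  Set.injOn_univ.1 h.1.injOn

theorem IsRanking.card_filter_lt (h : IsRanking L σ) (i : Fin K) :
    (Finset.univ.filter fun j => σ j < σ i).card = σ i - 1 := by
  rw [← Finset.card_image_of_injective _ h.injective]
  have : (Finset.univ.filter fun j => σ j < σ i).image σ = Finset.Ico 1 (σ i) := by
    ext n
    simp only [Finset.mem_image, Finset.mem_filter, Finset.mem_univ, true_and, Finset.mem_Ico]
    constructor
    · rintro ⟨j, hj, rfl⟩; exact ⟨h.one_le j, hj⟩
    · rintro ⟨h1, h2⟩
      have hK := (h.1.mapsTo (Set.mem_univ i)).2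
      obtain ⟨j, -, rfl⟩ := h.1.surjOn (show n ∈ Set.Icc 1 K from ⟨h1, h2.le.trans hK⟩)
      exact ⟨j, h2, rfl⟩
  rw [this, Nat.card_Ico]

theorem IsRanking.eq_one_of_forall_lt (h : IsRanking L σ) {i : Fin K}
    (hi : ∀ j, j ≠ i → L i < L j) : σ i = 1 := by
  have h1 : (Finset.univ.filter fun j => σ j < σ i) = ∅ := by
    refine Finset.filter_eq_empty_iff.2 fun j _ hj => ?_
    obtain ⟨hne, hle⟩ := h.le_of_lt hj
    exact absurd (hi j hne) hle.not_gt
  have h2 := h.card_filter_lt i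
  rw [h1, Finset.card_empty] at h2
  have := h.one_le i
  omega

theorem IsRanking.sum_comp (h : IsRanking L σ) (f : ℕ → ℝ) :
    ∑ i, f (σ i) = ∑ n ∈ Finset.Icc 1 K, f n := by
  rw [← h.image_univ, Finset.sum_image fun i _ j _ hij => h.injective hij]

end Ranking

/-! ### Exploration weights and their relation to the winning probabilities -/

section ExploreWeight

variable {K : ℕ} {α η : ℝ} {L : Fin K → ℝ} {σ : Fin K → ℕ}

theorem lossGap_nonneg (L : Fin K → ℝ) (i : Fin K) : 0 ≤ lossGap L i :=
  sub_nonneg.2 (ciInf_le (Set.finite_range L).bddBelow i)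

theorem exists_lossGap_eq (L : Fin K → ℝ) (i : Fin K) : ∃ k, lossGap L i = L i - L k := by
  have : Nonempty (Fin K) := ⟨i⟩
  obtain ⟨k, hk⟩ := exists_eq_ciInf_of_finite (f := L)
  exact ⟨k, by rw [lossGap, hk]⟩

theorem lossGap_eq_of_forall_le {i : Fin K} (hi : ∀ j, L i ≤ L j) (j : Fin K) :
    lossGap L j = L j - L i := by
  have : Nonempty (Fin K) := ⟨i⟩
  rw [lossGap, le_antisymm (ciInf_le (Set.finite_range L).bddBelow i) (le_ciInf hi)]

/-- The exponent is split off so that the base is the quantity summed in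
`leader_of_one_sub_winProb_lt`, ready for a power-mean inequality. -/
theorem exploreWeight_le_gap (hη : 0 ≤ η) (hα : 0 < α) (i : Fin K) :
    exploreWeight α η L σ i ≤ ((1 + η * lossGap L i) ^ (-α)) ^ ((α + 1) / (2 * α)) := by
  have h0 : 0 < 1 + η * lossGap L i := by
    have := mul_nonneg hη (lossGap_nonneg L i); linarith
  rw [← Real.rpow_mul h0.le, show -α * ((α + 1) / (2 * α)) = -((α + 1) / 2) by field_simp,
    Real.rpow_neg h0.le, ← Real.inv_rpow h0.le, ← one_div]
  refine Real.rpow_le_rpow (le_min (by positivity) (by positivity)) (min_le_left _ _) (by positivity)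

theorem exploreWeight_le_rank (hη : 0 ≤ η) (hα : 0 < α) (i : Fin K) :
    exploreWeight α η L σ i ≤ (σ i : ℝ) ^ (-((α + 1) / (2 * α))) := by
  have h0 : 0 < 1 + η * lossGap L i := by
    have := mul_nonneg hη (lossGap_nonneg L i); linarith
  have h1 : (0 : ℝ) ≤ σ i := Nat.cast_nonneg _
  rw [show -((α + 1) / (2 * α)) = -(1 / α * ((α + 1) / 2)) by field_simp,
    Real.rpow_neg h1, Real.rpow_mul h1, ← Real.inv_rpow (by positivity), ← one_div]
  refine Real.rpow_le_rpow (le_min (by positivity) (by positivity)) (min_le_right _ _) (by positivity)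

theorem exploreWeight_pos (hη : 0 ≤ η) (hσ : IsRanking L σ) (i : Fin K) :
    0 < exploreWeight α η L σ i := by
  have h0 : 0 < 1 + η * lossGap L i := by
    have := mul_nonneg hη (lossGap_nonneg L i); linarith
  have h1 : (0 : ℝ) < σ i := by exact_mod_cast hσ.one_le i
  exact Real.rpow_pos_of_pos (lt_min (by positivity) (by positivity)) _

/-- This explains the design of the weights: the two entries are, up to constants, the rates of
decrease in `winProb_sub_le_of_gap` and `winProb_sub_le_of_card`. -/
theorem exploreWeight_sq (hη : 0 ≤ η) (hα : 0 < α) (i : Fin K) :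
    exploreWeight α η L σ i ^ 2
      = min ((1 + η * lossGap L i) ^ (-(α + 1))) ((σ i : ℝ) ^ (-(1 + 1 / α))) := by
  have h0 : 0 < 1 + η * lossGap L i := by
    have := mul_nonneg hη (lossGap_nonneg L i); linarith
  have h1 : (0 : ℝ) ≤ σ i := Nat.cast_nonneg _
  have h2 : 0 ≤ min (1 / (1 + η * lossGap L i)) (1 / (σ i : ℝ) ^ (1 / α)) :=
    le_min (by positivity) (by positivity)
  rw [exploreWeight, ← Real.rpow_mul_natCast h2, show (α + 1) / 2 * ((2 : ℕ) : ℝ) = α + 1 by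
    push_cast; ring]
  have e1 : (1 + η * lossGap L i) ^ (-(α + 1)) = (1 / (1 + η * lossGap L i)) ^ (α + 1) := by
    rw [one_div, Real.inv_rpow h0.le, Real.rpow_neg h0.le]
  have e2 : (σ i : ℝ) ^ (-(1 + 1 / α)) = (1 / (σ i : ℝ) ^ (1 / α)) ^ (α + 1) := by
    rw [one_div ((σ i : ℝ) ^ (1 / α)), Real.inv_rpow (by positivity), ← Real.rpow_mul h1,
      ← Real.rpow_neg h1]
    congr 1; field_simp
  rw [e1, e2]
  rcases le_total (1 / (1 + η * lossGap L i)) (1 / (σ i : ℝ) ^ (1 / α)) with h | h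
  · rw [min_eq_left h, min_eq_left (Real.rpow_le_rpow (by positivity) h (by positivity))]
  · rw [min_eq_right h, min_eq_right (Real.rpow_le_rpow (by positivity) h (by positivity))]

theorem sum_Icc_rpow_neg_le {s : ℝ} (hs0 : 0 ≤ s) (hs1 : s < 1) (K : ℕ) :
    ∑ n ∈ Finset.Icc 1 K, (n : ℝ) ^ (-s) ≤ (K : ℝ) ^ (1 - s) / (1 - s) := by
  have hp : 0 < 1 - s := by linarith
  induction K with
  | zero => simp [Real.zero_rpow hp.ne']
  | succ n ih =>
    rw [Finset.sum_Icc_succ_top (by omega)]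
    have hn : (0 : ℝ) < (n + 1 : ℕ) := by positivity
    set m : ℝ := ((n + 1 : ℕ) : ℝ) with hm
    -- Bernoulli's inequality for the concave power `1 - s`, with `n = m (1 - 1/m)`: it compares the
    -- new summand with the increment of `m ^ (1 - s) / (1 - s)`.
    have h1 : (1 + -(1 / m)) ^ (1 - s) ≤ 1 + (1 - s) * -(1 / m) := by
      refine rpow_one_add_le_one_add_mul_self ?_ hp.le (by linarith)
      rw [neg_le_neg_iff, div_le_one hn, hm]
      exact_mod_cast Nat.succ_le_succ (Nat.zero_le n)
    have h2 : (n : ℝ) = m * (1 + -(1 / m)) := by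
      rw [mul_add, mul_one, mul_neg, mul_one_div_cancel hn.ne', hm]; push_cast; ring
    have h3 : (0 : ℝ) ≤ 1 + -(1 / m) := by
      by_contra! hneg
      have : (n : ℝ) < 0 := by rw [h2]; exact mul_neg_of_pos_of_neg hn hneg
      exact absurd this (Nat.cast_nonneg n).not_gt
    have h4 : (n : ℝ) ^ (1 - s) ≤ m ^ (1 - s) * (1 + (1 - s) * -(1 / m)) := by
      rw [h2, Real.mul_rpow hn.le h3]
      gcongr
    have h5 : m ^ (-s) = m ^ (1 - s) * (1 / m) := by
      rw [one_div, ← Real.rpow_neg_one m, ← Real.rpow_add hn]; congr 1; ring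
    rw [h5, le_div_iff₀ hp]
    rw [le_div_iff₀ hp] at ih
    nlinarith

theorem sum_exploreWeight_le (hη : 0 ≤ η) (hα : 1 < α) (hσ : IsRanking L σ) :
    ∑ i, exploreWeight α η L σ i
      ≤ 2 * α / (α - 1) * (K : ℝ) ^ ((1 - 1 / α) / 2) := by
  have hα0 : 0 < α := by linarith
  have hs : 1 - (α + 1) / (2 * α) = (1 - 1 / α) / 2 := by field_simp; ring
  have hs' : 1 - (α + 1) / (2 * α) = (α - 1) / (2 * α) := by field_simp; ring
  calc ∑ i, exploreWeight α η L σ i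
      ≤ ∑ i, (σ i : ℝ) ^ (-((α + 1) / (2 * α))) :=
        Finset.sum_le_sum fun i _ => exploreWeight_le_rank hη hα0 i
    _ = ∑ n ∈ Finset.Icc 1 K, (n : ℝ) ^ (-((α + 1) / (2 * α))) :=
        hσ.sum_comp fun n => (n : ℝ) ^ (-((α + 1) / (2 * α)))
    _ ≤ (K : ℝ) ^ (1 - (α + 1) / (2 * α)) / (1 - (α + 1) / (2 * α)) := by
        refine sum_Icc_rpow_neg_le (by positivity) ?_ K
        rw [div_lt_one (by positivity)]; linarith
    _ = 2 * α / (α - 1) * (K : ℝ) ^ ((1 - 1 / α) / 2) := by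
        rw [← hs, hs']
        have : α - 1 ≠ 0 := by linarith
        field_simp

/-- The constant in the bound of the decrease of the winning probability of an arm by the square of
its exploration weight. -/
noncomputable def winDiffConst (α : ℝ) : ℝ :=
  α * (1 + 2 ^ (1 + 1 / α) * ((1 + 1 / α) * Real.Gamma (1 + 1 / α)))

theorem winDiffConst_pos (hα : 0 < α) : 0 < winDiffConst α := by
  have := Real.Gamma_pos_of_pos (show 0 < 1 + 1 / α by positivity)
  unfold winDiffConst; positivity

/-- Whichever entry of the minimum is active, the matching estimate applies: the gap to the
minimiser, or the `σ i - 1` better ranked arms. For rank `1` there are no such arms and the trivial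
gap `0` suffices. -/
theorem winProb_sub_le_exploreWeight_sq [Nontrivial (Fin K)] [hα : Fact (1 < α)] (hη : 0 ≤ η)
    (hσ : IsRanking L σ) (i : Fin K) {x : ℝ} (hx : 0 ≤ x) :
    winProb α (η • L) i - winProb α (η • L + Pi.single i x) i
      ≤ winDiffConst α * x * exploreWeight α η L σ i ^ 2 := by
  have hα1 : 1 < α := hα.out
  have hα0 : 0 < α := by linarith
  have hΓ := Real.Gamma_pos_of_pos (show 0 < 1 + 1 / α by positivity)
  have h0 : 0 < 1 + η * lossGap L i := by
    have := mul_nonneg hη (lossGap_nonneg L i); linarith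
  have hσ0 : (0 : ℝ) < σ i := by exact_mod_cast hσ.one_le i
  rw [exploreWeight_sq hη hα0, winDiffConst]
  rcases min_cases ((1 + η * lossGap L i) ^ (-(α + 1))) ((σ i : ℝ) ^ (-(1 + 1 / α)))
    with ⟨h, -⟩ | ⟨h, -⟩
  · rw [h]
    refine (winProb_sub_le_of_gap (η • L) i hx (mul_nonneg hη (lossGap_nonneg L i)) ?_).trans ?_
    · obtain ⟨k, hk⟩ := exists_lossGap_eq L i
      by_cases hki : k = i
      · left; rw [hk, hki]; simp
      · right; exact ⟨k, hki, by rw [hk]; simp [mul_sub]⟩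
    · rw [mul_assoc α, mul_assoc α, mul_assoc α]
      refine mul_le_mul_of_nonneg_left ?_ hα0.le
      rw [mul_assoc]
      refine le_mul_of_one_le_left (by positivity) ?_
      have : 0 ≤ 2 ^ (1 + 1 / α) * ((1 + 1 / α) * Real.Gamma (1 + 1 / α)) := by positivity
      linarith
  · rw [h]
    rcases (hσ.one_le i).eq_or_lt with h1 | h1
    · have h2 := winProb_sub_le_of_gap (α := α) (η • L) i hx le_rfl (Or.inl rfl)
      rw [add_zero, Real.one_rpow, mul_one] at h2
      rw [← h1, Nat.cast_one, Real.one_rpow, mul_one]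
      refine h2.trans ?_
      rw [mul_assoc α]
      refine mul_le_mul_of_nonneg_left (le_mul_of_one_le_left hx ?_) hα0.le
      have : 0 ≤ 2 ^ (1 + 1 / α) * ((1 + 1 / α) * Real.Gamma (1 + 1 / α)) := by positivity
      linarith
    · set J := Finset.univ.filter fun j => σ j < σ i with hJ
      have hcard : J.card = σ i - 1 := hσ.card_filter_lt i
      have hJne : J.Nonempty := Finset.card_pos.1 (by omega)
      have h2 := winProb_sub_le_of_card (α := α) (η • L) i hx J hJne fun j hj => by
        obtain ⟨hne, hle⟩ := hσ.le_of_lt (Finset.mem_filter.1 hj).2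
        exact ⟨hne, by simpa using mul_le_mul_of_nonneg_left hle hη⟩
      have h3 : (J.card : ℝ) ^ (-(1 + 1 / α)) ≤ 2 ^ (1 + 1 / α) * (σ i : ℝ) ^ (-(1 + 1 / α)) := by
        -- Replacing `σ i - 1` by `σ i / 2`, valid for rank at least `2`, is the source of the
        -- factor `2 ^ (1 + 1/α)` in `winDiffConst`.
        have h4 : (σ i : ℝ) / 2 ≤ J.card := by
          rw [hcard, Nat.cast_sub h1.le]
          have : (2 : ℝ) ≤ σ i := by exact_mod_cast h1
          push_cast; linarith
        refine (Real.rpow_le_rpow_of_nonpos (by positivity) h4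
          (by rw [neg_nonpos]; positivity)).trans (le_of_eq ?_)
        rw [Real.div_rpow hσ0.le (by norm_num), Real.rpow_neg (by norm_num : (0 : ℝ) ≤ 2)]
        field_simp
      refine h2.trans ?_
      have hαx : 0 ≤ α * x := by positivity
      have hσp : 0 ≤ (σ i : ℝ) ^ (-(1 + 1 / α)) := by positivity
      calc α * x * ((1 + 1 / α) * Real.Gamma (1 + 1 / α) * (J.card : ℝ) ^ (-(1 + 1 / α)))
          ≤ α * x * ((1 + 1 / α) * Real.Gamma (1 + 1 / α)
              * (2 ^ (1 + 1 / α) * (σ i : ℝ) ^ (-(1 + 1 / α)))) := by gcongr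
        _ ≤ α * x * ((1 + 1 / α) * Real.Gamma (1 + 1 / α)
              * (2 ^ (1 + 1 / α) * (σ i : ℝ) ^ (-(1 + 1 / α))) + (σ i : ℝ) ^ (-(1 + 1 / α))) := by
            gcongr; linarith
        _ = _ := by ring

end ExploreWeight

/-! ### Stability: coarse bound, refined bound near the leader, and their combination -/

section Stability

theorem sum_rpow_le_card_rpow_mul {ι : Type*} (s : Finset ι) {a : ι → ℝ} (ha : ∀ i ∈ s, 0 ≤ a i)
    {p : ℝ} (hp0 : 0 < p) (hp1 : p ≤ 1) :
    ∑ i ∈ s, a i ^ p ≤ (s.card : ℝ) ^ (1 - p) * (∑ i ∈ s, a i) ^ p := by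
  have h := Real.rpow_sum_le_const_mul_sum_rpow_of_nonneg (s := s) (f := fun i => a i ^ p)
    (p := 1 / p) (by rw [le_div_iff₀ hp0]; linarith) fun i hi => Real.rpow_nonneg (ha i hi) _
  have e : ∀ i ∈ s, (a i ^ p) ^ (1 / p) = a i := fun i hi => by
    rw [← Real.rpow_mul (ha i hi), mul_one_div_cancel hp0.ne', Real.rpow_one]
  rw [Finset.sum_congr rfl e] at h
  have hS : 0 ≤ ∑ i ∈ s, a i ^ p := Finset.sum_nonneg fun i hi => Real.rpow_nonneg (ha i hi) _
  have h2 := Real.rpow_le_rpow (Real.rpow_nonneg hS _) h hp0.le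
  rw [← Real.rpow_mul hS, one_div_mul_cancel hp0.ne', Real.rpow_one,
    Real.mul_rpow (by positivity) (Finset.sum_nonneg ha), ← Real.rpow_mul (by positivity)] at h2
  convert h2 using 3
  field_simp

variable {K : ℕ} {α η : ℝ} {L : Fin K → ℝ} {σ : Fin K → ℕ}

/-- The total decrease of the winning probabilities when the loss estimate of each arm is
increased by its largest possible importance-weighted increment. -/
noncomputable def stability (α η : ℝ) (L : Fin K → ℝ) (σ : Fin K → ℕ) : ℝ :=
  ∑ i, (winProb α (η • L) i - winProb α (η • L + Pi.single i (η / exploreProb α η L σ i)) i)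

theorem sum_exploreWeight_pos [Nonempty (Fin K)] (hη : 0 ≤ η) (hσ : IsRanking L σ) :
    0 < ∑ i, exploreWeight α η L σ i :=
  Finset.sum_pos (fun i _ => exploreWeight_pos hη hσ i) Finset.univ_nonempty

theorem exploreProb_pos (hη : 0 ≤ η) (hσ : IsRanking L σ) (i : Fin K) :
    0 < exploreProb α η L σ i := by
  have : Nonempty (Fin K) := ⟨i⟩
  exact div_pos (exploreWeight_pos hη hσ i) (sum_exploreWeight_pos hη hσ)

variable [hα : Fact (1 < α)]

/-- The shift is `η Q / q_i`, which cancels one of the two factors `q_i`. The sum over the arms is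
then of order `η Q ^ 2`. -/
theorem winProb_sub_le_exploreWeight [Nontrivial (Fin K)] (hη : 0 ≤ η) (hσ : IsRanking L σ)
    (i : Fin K) :
    winProb α (η • L) i - winProb α (η • L + Pi.single i (η / exploreProb α η L σ i)) i
      ≤ winDiffConst α * (η * ∑ j, exploreWeight α η L σ j) * exploreWeight α η L σ i := by
  have hq := exploreWeight_pos (α := α) hη hσ i
  have hQ := sum_exploreWeight_pos (α := α) hη hσ
  have hx : 0 ≤ η / exploreProb α η L σ i := div_nonneg hη (exploreProb_pos hη hσ i).le
  refine (winProb_sub_le_exploreWeight_sq hη hσ i hx).trans (le_of_eq ?_)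
  rw [exploreProb]
  field_simp

theorem stability_le_sqrt [Nontrivial (Fin K)] (hη : 0 ≤ η) (hσ : IsRanking L σ) {c v : ℝ}
    (hv : η * (K : ℝ) ^ (1 - 1 / α) ≤ c * v) :
    stability α η L σ ≤ winDiffConst α * (2 * α / (α - 1)) ^ 2 * c * v := by
  have hα1 : 1 < α := hα.out
  have hC := winDiffConst_pos (α := α) (by linarith)
  set Q := ∑ j, exploreWeight α η L σ j with hQdef
  have hQ0 : 0 < Q := sum_exploreWeight_pos hη hσ
  have hQ : Q ≤ 2 * α / (α - 1) * (K : ℝ) ^ ((1 - 1 / α) / 2) := sum_exploreWeight_le hη hα1 hσ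
  have hk : ((K : ℝ) ^ ((1 - 1 / α) / 2)) ^ 2 = (K : ℝ) ^ (1 - 1 / α) := by
    rw [← Real.rpow_mul_natCast (Nat.cast_nonneg K)]; congr 1; push_cast; ring
  calc stability α η L σ
      ≤ ∑ i, winDiffConst α * (η * Q) * exploreWeight α η L σ i :=
        Finset.sum_le_sum fun i _ => winProb_sub_le_exploreWeight hη hσ i
    _ = winDiffConst α * (η * Q ^ 2) := by rw [← Finset.mul_sum]; ring
    _ ≤ winDiffConst α * (η * (2 * α / (α - 1) * (K : ℝ) ^ ((1 - 1 / α) / 2)) ^ 2) := by gcongr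
    _ = winDiffConst α * (2 * α / (α - 1)) ^ 2 * (η * (K : ℝ) ^ (1 - 1 / α)) := by
        rw [mul_pow, hk]; ring
    _ ≤ winDiffConst α * (2 * α / (α - 1)) ^ 2 * (c * v) := by gcongr
    _ = _ := by ring

/-- The leader has weight `1`, so its shift is only `η Q` and `winProb_sub_le_of_leader` gives a
decrease of order `η Q W`. The rivals contribute `η Q S` with `S = Q - 1`, and `S` is small because
their gaps are large. -/
theorem stability_le_of_leader [Nontrivial (Fin K)] (hα3 : α ≤ 3) (hη : 0 ≤ η)
    (hσ : IsRanking L σ) {c v : ℝ} (hv : η * (K : ℝ) ^ (1 - 1 / α) ≤ c * v)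
    (hsmall : 2 * α / (α - 1) * (c * v) ≤ 1 / 2) {i : Fin K}
    (hW : 1 - winProb α (η • L) i < 1 / 16) :
    stability α η L σ
      ≤ (α * 2 ^ α * 24 * (2 * α / (α - 1)) * c + winDiffConst α * 600 * c) * v
          * (1 - winProb α (η • L) i) ^ (2 / 3 : ℝ) := by
  have hα1 : 1 < α := hα.out
  have hα0 : 0 < α := by linarith
  have hα' : 0 < α - 1 := by linarith
  have hC := winDiffConst_pos hα0
  obtain ⟨hlead, hsum⟩ := leader_of_one_sub_winProb_lt hα3 (η • L) i hW
  set W := 1 - winProb α (η • L) i with hWdef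
  have hW0 : 0 ≤ W := sub_nonneg.2 (winProb_le_one _ _)
  have hW1 : W ≤ 1 := by linarith
  have hη0 : 0 < η := by
    refine hη.lt_of_ne fun h => ?_
    obtain ⟨j, hj⟩ := exists_ne i
    have := hlead j hj
    simp [← h] at this
  have hL : ∀ j, j ≠ i → L i < L j := fun j hj => by
    have := hlead j hj
    simpa [hη0] using this
  have hLle : ∀ j, L i ≤ L j := fun j => by
    by_cases hj : j = i
    · rw [hj]
    · exact (hL j hj).le
  have hgap : ∀ j, η * lossGap L j = (η • L) j - (η • L) i := fun j => by
    rw [lossGap_eq_of_forall_le hLle]; simp [mul_sub]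
  set k := (K : ℝ) ^ ((1 - 1 / α) / 2) with hk
  have hexp : 0 ≤ (1 - 1 / α) / 2 := by
    have : 1 / α ≤ 1 := by rw [div_le_one hα0]; exact hα1.le
    linarith
  have hK1 : (1 : ℝ) ≤ K := by
    have : 0 < K := i.pos
    exact_mod_cast this
  have hk1 : 1 ≤ k := Real.one_le_rpow hK1 hexp
  have hk2 : k ^ 2 = (K : ℝ) ^ (1 - 1 / α) := by
    rw [hk, ← Real.rpow_mul_natCast (Nat.cast_nonneg K)]; congr 1; push_cast; ring
  set q := exploreWeight α η L σ with hq
  have hqpos : ∀ j, 0 < q j := fun j => exploreWeight_pos hη hσ j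
  set Q := ∑ j, q j with hQdef
  have hQ0 : 0 < Q := sum_exploreWeight_pos hη hσ
  have hQ : Q ≤ 2 * α / (α - 1) * k := sum_exploreWeight_le hη hα1 hσ
  have hηk2 : η * k ^ 2 ≤ c * v := hk2 ▸ hv
  have hηk : η * k ≤ c * v := by
    refine le_trans ?_ hηk2
    gcongr; nlinarith
  have hηQ : η * Q ≤ 2 * α / (α - 1) * (c * v) := by
    calc η * Q ≤ η * (2 * α / (α - 1) * k) := by gcongr
      _ = 2 * α / (α - 1) * (η * k) := by ring
      _ ≤ _ := by gcongr
  have hcv : 0 ≤ c * v := (mul_nonneg hη (sq_nonneg k)).trans hηk2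
  have hqi : q i = 1 := by
    rw [hq, exploreWeight, hgap, hσ.eq_one_of_forall_lt hL]; simp
  have hpi : η / exploreProb α η L σ i = η * Q := by
    rw [exploreProb, ← hq, hqi, ← hQdef]; field_simp
  set s := (α + 1) / (2 * α) with hs
  have hs0 : 0 < s := by positivity
  have hs1 : s ≤ 1 := by rw [hs, div_le_one (by positivity)]; linarith
  -- Equivalent to `α ≤ 3`; it allows `W ^ s` to be replaced by `W ^ (2/3)`, since `W ≤ 1`.
  have hs23 : 2 / 3 ≤ s := by rw [hs, le_div_iff₀ (by positivity)]; linarith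
  set S := ∑ j ∈ Finset.univ.erase i, q j with hSdef
  have hS0 : 0 ≤ S := Finset.sum_nonneg fun j _ => (hqpos j).le
  have hQS : Q = 1 + S := by
    rw [hQdef, ← Finset.add_sum_erase _ _ (Finset.mem_univ i), hqi]
  set w := W ^ (2 / 3 : ℝ) with hw
  have hw0 : 0 ≤ w := Real.rpow_nonneg hW0 _
  have hw1 : w ≤ 1 := Real.rpow_le_one hW0 hW1 (by norm_num)
  have hWw : W ≤ w := by
    calc W = W ^ (1 : ℝ) := (Real.rpow_one W).symm
      _ ≤ w := Real.rpow_le_rpow_of_exponent_ge_of_imp hW0 hW1 (by norm_num) (by norm_num)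
  have hS : S ≤ 24 * k * w := by
    have ha : ∀ j ∈ Finset.univ.erase i, 0 ≤ (1 + ((η • L) j - (η • L) i)) ^ (-α) := fun j hj =>
      Real.rpow_nonneg (by linarith [hlead j (Finset.ne_of_mem_erase hj)]) _
    calc S ≤ ∑ j ∈ Finset.univ.erase i, ((1 + ((η • L) j - (η • L) i)) ^ (-α)) ^ s := by
          refine Finset.sum_le_sum fun j _ => ?_
          rw [← hgap]
          exact exploreWeight_le_gap hη hα0 j
      _ ≤ ((Finset.univ.erase i).card : ℝ) ^ (1 - s)
            * (∑ j ∈ Finset.univ.erase i, (1 + ((η • L) j - (η • L) i)) ^ (-α)) ^ s :=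
          sum_rpow_le_card_rpow_mul _ ha hs0 hs1
      _ ≤ (K : ℝ) ^ (1 - s) * (24 * W) ^ s := by
          have h1 : ((Finset.univ.erase i).card : ℝ) ≤ K := by
            exact_mod_cast (Finset.card_le_univ _).trans (by simp)
          exact mul_le_mul (Real.rpow_le_rpow (Nat.cast_nonneg _) h1 (by linarith))
            (Real.rpow_le_rpow (Finset.sum_nonneg ha) hsum hs0.le)
            (Real.rpow_nonneg (Finset.sum_nonneg ha) _) (by positivity)
      _ = k * (24 ^ s * W ^ s) := by
          rw [Real.mul_rpow (by norm_num) hW0]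
          -- `1 - s = (1 - 1/α) / 2`, so the power-mean inequality loses exactly the factor `k`.
          congr 2; rw [hs]; field_simp; ring
      _ ≤ k * (24 * w) := by
          have h1 : (24 : ℝ) ^ s ≤ 24 := by
            calc (24 : ℝ) ^ s ≤ 24 ^ (1 : ℝ) :=
                  Real.rpow_le_rpow_of_exponent_le (by norm_num) hs1
              _ = 24 := Real.rpow_one _
          have h2 : W ^ s ≤ w :=
            Real.rpow_le_rpow_of_exponent_ge_of_imp hW0 hW1 hs23 (by intro _ h; linarith)
          gcongr
      _ = 24 * k * w := by ring
  have hηQS : η * Q * S ≤ 600 * (c * v) * w := by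
    have h1 : S ^ 2 ≤ (24 * k * w) ^ 2 := by gcongr
    have h2 : w ^ 2 ≤ w := by nlinarith
    calc η * Q * S = η * S + η * S ^ 2 := by rw [hQS]; ring
      _ ≤ η * (24 * k * w) + η * (24 * k * w) ^ 2 := by gcongr
      _ = 24 * (η * k) * w + 576 * (η * k ^ 2) * w ^ 2 := by ring
      _ ≤ 24 * (c * v) * w + 576 * (c * v) * w := by gcongr
      _ = 600 * (c * v) * w := by ring
  have hi : winProb α (η • L) i - winProb α (η • L + Pi.single i (η / exploreProb α η L σ i)) i
      ≤ α * 2 ^ α * 24 * (2 * α / (α - 1)) * (c * v) * w := by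
    rw [hpi]
    have hllin : ∀ j, (η • L) i ≤ (η • L) j := fun j => by
      by_cases hj : j = i
      · rw [hj]
      · exact (hlead j hj).le
    refine (winProb_sub_le_of_leader (η • L) i (by positivity) (hηQ.trans hsmall) hllin).trans ?_
    calc α * (η * Q) * (2 ^ α * ∑ j ∈ Finset.univ.erase i, (1 + ((η • L) j - (η • L) i)) ^ (-α))
        ≤ α * (2 * α / (α - 1) * (c * v)) * (2 ^ α * (24 * w)) := by
          have h1 : ∑ j ∈ Finset.univ.erase i, (1 + ((η • L) j - (η • L) i)) ^ (-α) ≤ 24 * w :=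
            hsum.trans (by linarith)
          have h2 := mul_le_mul_of_nonneg_left h1 (show (0 : ℝ) ≤ 2 ^ α by positivity)
          refine (mul_le_mul_of_nonneg_left h2 (by positivity)).trans ?_
          gcongr
      _ = _ := by ring
  rw [stability, ← Finset.add_sum_erase _ _ (Finset.mem_univ i)]
  calc _ ≤ α * 2 ^ α * 24 * (2 * α / (α - 1)) * (c * v) * w
        + ∑ j ∈ Finset.univ.erase i, winDiffConst α * (η * Q) * q j := by
        refine add_le_add hi (Finset.sum_le_sum fun j _ => ?_)
        exact winProb_sub_le_exploreWeight hη hσ j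
    _ = α * 2 ^ α * 24 * (2 * α / (α - 1)) * (c * v) * w + winDiffConst α * (η * Q * S) := by
        rw [← Finset.mul_sum]; ring
    _ ≤ α * 2 ^ α * 24 * (2 * α / (α - 1)) * (c * v) * w
        + winDiffConst α * (600 * (c * v) * w) := by gcongr
    _ = _ := by ring

/-- A Young inequality, applied below to `y = W ^ (1/3)` so that `y ^ 3 = W` can be absorbed. -/
theorem mul_sq_le_quarter_cube_add {A y : ℝ} (hA : 0 ≤ A) (hy : 0 ≤ y) :
    A * y ^ 2 ≤ y ^ 3 / 4 + 16 * A ^ 3 := by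
  rcases le_total (4 * A) y with h | h
  · nlinarith [pow_nonneg hA 3, mul_nonneg (sq_nonneg y) (sub_nonneg.2 h)]
  · have : y ^ 2 ≤ (4 * A) ^ 2 := by gcongr
    nlinarith [pow_nonneg hy 3, mul_le_mul_of_nonneg_left this hA]

/-- In the application `v = √(K/t)` and `D` is the minimal gap. The term `D W / 4` is absorbed by
the regret; the remainder is linear in `v / D` in early rounds and cubic in late ones, so that it is
summable. -/
theorem exists_stability_le (hα3 : α ≤ 3) {c : ℝ} (hc : 0 < c) :
    ∃ C : ℝ, 0 < C ∧ ∀ (K : ℕ) [Nontrivial (Fin K)] (η : ℝ) (L : Fin K → ℝ) (σ : Fin K → ℕ)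
      (v D : ℝ) (i : Fin K), 0 ≤ η → IsRanking L σ → η * (K : ℝ) ^ (1 - 1 / α) ≤ c * v → 0 ≤ v →
        0 < D → D ≤ 1 →
        stability α η L σ ≤ D * (1 - winProb α (η • L) i) / 4
          + C * (D * min (v / D) ((v / D) ^ 3)) := by
  have hα1 : 1 < α := hα.out
  have hα0 : 0 < α := by linarith
  have hα' : 0 < α - 1 := by linarith
  have hC := winDiffConst_pos hα0
  set A := 2 * α / (α - 1) with hA
  have hA0 : 0 < A := by positivity
  set C₁ := α * 2 ^ α * 24 * A * c + winDiffConst α * 600 * c with hC₁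
  set C₂ := winDiffConst α * A ^ 2 * c with hC₂
  have hC₁0 : 0 < C₁ := by positivity
  have hC₂0 : 0 < C₂ := by positivity
  set C₃ := C₁ + 16 * C₂ with hC₃
  have hC₃0 : 0 < C₃ := by positivity
  -- The largest `v` for which the leader's shift is guaranteed to be at most `1/2`. Beyond it, `u ≥
  -- v > κ` makes the coarse bound at most a multiple of `u ^ 3`.
  set κ := 1 / (2 * A * c) with hκ
  have hκ0 : 0 < κ := by positivity
  refine ⟨C₂ + 16 * C₃ ^ 3 + C₂ / κ ^ 2, by positivity, ?_⟩
  intro K _ η L σ v D i hη hσ hv hv0 hD0 hD1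
  set W := 1 - winProb α (η • L) i with hW
  have hW0 : 0 ≤ W := sub_nonneg.2 (winProb_le_one _ _)
  have hW1 : W ≤ 1 := sub_le_self _ (winProb_nonneg _ _)
  set u := v / D with hu
  have hu0 : 0 ≤ u := by positivity
  have hvu : v = D * u := by rw [hu]; field_simp
  have hvu' : v ≤ u := by rw [hvu]; exact mul_le_of_le_one_left hu0 hD1
  have hcoarse : stability α η L σ ≤ C₂ * v := stability_le_sqrt hη hσ hv
  have hbase : stability α η L σ ≤ D * W / 4 + (16 * C₃ ^ 3 + C₂ / κ ^ 2) * (D * u ^ 3) := by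
    rcases le_or_gt v κ with hvκ | hvκ
    · have hy : stability α η L σ ≤ C₃ * v * W ^ (2 / 3 : ℝ) := by
        rcases lt_or_ge W (1 / 16) with hW16 | hW16
        · have hsmall : A * (c * v) ≤ 1 / 2 := by
            rw [hκ, le_div_iff₀ (by positivity)] at hvκ
            linarith
          refine (stability_le_of_leader hα3 hη hσ hv hsmall hW16).trans ?_
          gcongr
          rw [hC₃]; linarith
        · have h1 : 1 ≤ 16 * W ^ (2 / 3 : ℝ) := by
            have : W ^ (1 : ℝ) ≤ W ^ (2 / 3 : ℝ) :=
              Real.rpow_le_rpow_of_exponent_ge (by linarith) hW1 (by norm_num)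
            rw [Real.rpow_one] at this
            linarith
          calc stability α η L σ ≤ C₂ * v := hcoarse
            _ ≤ C₂ * v * (16 * W ^ (2 / 3 : ℝ)) := le_mul_of_one_le_right (by positivity) h1
            _ = 16 * C₂ * v * W ^ (2 / 3 : ℝ) := by ring
            _ ≤ C₃ * v * W ^ (2 / 3 : ℝ) := by gcongr; rw [hC₃]; linarith
      have hy0 : 0 ≤ W ^ (1 / 3 : ℝ) := Real.rpow_nonneg hW0 _
      have e2 : W ^ (2 / 3 : ℝ) = (W ^ (1 / 3 : ℝ)) ^ 2 := by
        rw [← Real.rpow_mul_natCast hW0]; norm_num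
      have e3 : W = (W ^ (1 / 3 : ℝ)) ^ 3 := by
        rw [← Real.rpow_mul_natCast hW0]; norm_num
      have hyoung := mul_sq_le_quarter_cube_add (A := C₃ * u) (by positivity) hy0
      rw [← e2, ← e3] at hyoung
      calc stability α η L σ ≤ C₃ * v * W ^ (2 / 3 : ℝ) := hy
        _ = D * (C₃ * u * W ^ (2 / 3 : ℝ)) := by rw [hvu]; ring
        _ ≤ D * (W / 4 + 16 * (C₃ * u) ^ 3) := by gcongr
        _ = D * W / 4 + 16 * C₃ ^ 3 * (D * u ^ 3) := by ring
        _ ≤ _ := by gcongr; exact le_add_of_nonneg_right (by positivity)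
    · have h1 : u ≤ u ^ 3 / κ ^ 2 := by
        rw [le_div_iff₀ (by positivity)]
        have : κ ^ 2 ≤ u ^ 2 := by gcongr; linarith
        nlinarith
      calc stability α η L σ ≤ C₂ * v := hcoarse
        _ = C₂ * (D * u) := by rw [hvu]
        _ ≤ C₂ * (D * (u ^ 3 / κ ^ 2)) := by gcongr
        _ = C₂ / κ ^ 2 * (D * u ^ 3) := by ring
        _ ≤ D * W / 4 + (16 * C₃ ^ 3 + C₂ / κ ^ 2) * (D * u ^ 3) := by
            have : 0 ≤ D * W / 4 := by positivity
            have : 0 ≤ 16 * C₃ ^ 3 * (D * u ^ 3) := by positivity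
            linarith
  rcases le_total u (u ^ 3) with h | h
  · rw [min_eq_left h]
    calc stability α η L σ ≤ C₂ * (D * u) := hvu ▸ hcoarse
      _ ≤ (C₂ + 16 * C₃ ^ 3 + C₂ / κ ^ 2) * (D * u) := by
          gcongr; rw [add_assoc]; exact le_add_of_nonneg_right (by positivity)
      _ ≤ _ := le_add_of_nonneg_left (by positivity)
  · rw [min_eq_right h]
    refine hbase.trans ?_
    gcongr
    linarith

end Stability

/-! ### Be-the-leader and the penalty -/

section BeTheLeader

variable {K : ℕ}

/-- Here `b t` is the inverse learning rate and `I' t` already sees the estimate of round `t`.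
Changing `b` between rounds is charged to the current leader `I t`. -/
theorem sum_be_the_leader_le {T : ℕ} {L v : ℕ → Fin K → ℝ} {b : ℕ → ℝ} {r : Fin K → ℝ}
    {I I' : ℕ → Fin K} (hL1 : L 1 = 0) (hL : ∀ t ∈ Finset.Icc 1 T, L (t + 1) = L t + v t)
    (hb0 : b 0 = 0)
    (hI : ∀ t ∈ Finset.Icc 1 T, ∀ k, L t (I t) - b t * r (I t) ≤ L t k - b t * r k)
    (hI' : ∀ t ∈ Finset.Icc 1 T, ∀ k,
      L (t + 1) (I' t) - b t * r (I' t) ≤ L (t + 1) k - b t * r k) (k : Fin K) :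
    ∑ t ∈ Finset.Icc 1 T, v t (I' t)
      ≤ L (T + 1) k - b T * r k + ∑ t ∈ Finset.Icc 1 T, (b t - b (t - 1)) * r (I t) := by
  induction T generalizing k with
  | zero => simp [hL1, hb0]
  | succ n ih =>
    have hmem : n + 1 ∈ Finset.Icc 1 (n + 1) := by simp
    have hsub : ∀ t ∈ Finset.Icc 1 n, t ∈ Finset.Icc 1 (n + 1) := fun t ht => by
      simp only [Finset.mem_Icc] at ht ⊢; omega
    -- The comparator of the induction hypothesis is the new leader `I (n + 1)`, whose perturbation
    -- pays for the change from `b n` to `b (n + 1)`.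
    have ih' := ih (fun t ht => hL t (hsub t ht)) (fun t ht => hI t (hsub t ht))
      (fun t ht => hI' t (hsub t ht)) (I (n + 1))
    rw [Finset.sum_Icc_succ_top (by omega), Finset.sum_Icc_succ_top (by omega)]
    have h1 := hI' (n + 1) hmem k
    have h2 := hI (n + 1) hmem (I' (n + 1))
    have h3 := congrFun (hL (n + 1) hmem) (I' (n + 1))
    simp only [Pi.add_apply] at h3
    simp only [Nat.add_sub_cancel]
    linarith

variable {α : ℝ} [hα : Fact (1 < α)]

theorem mem_winSet_smul_iff {L r : Fin K → ℝ} {η b : ℝ} (hb : 0 < b) (hηb : η * b = 1)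
    {i : Fin K} : r ∈ winSet (η • L) i ↔ ∀ k, L i - b * r i ≤ L k - b * r k := by
  refine forall_congr' fun k => ?_
  rw [← mul_le_mul_iff_right₀ hb]
  have : ∀ j, b * ((η • L) j - r j) = L j - b * r j := fun j => by
    simp only [Pi.smul_apply, smul_eq_mul]
    linear_combination L j * hηb
  rw [this, this]

/-- The constant in the bound of the expected perturbation on an event by the probability of the
event. -/
noncomputable def tailConst (α : ℝ) : ℝ := 1 + α / (α - 1)

/-- For a fixed sequence of estimates only the marginal winning probabilities enter, so one
perturbation vector can be shared by all rounds and integrated at the end. The arm `k` is missing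
from the penalty, which is what permits self-bounding. -/
theorem sum_mul_winProb_le {T : ℕ} {L v : ℕ → Fin K → ℝ} {η b : ℕ → ℝ} (hL1 : L 1 = 0)
    (hL : ∀ t ∈ Finset.Icc 1 T, L (t + 1) = L t + v t) (hb0 : b 0 = 0)
    (hb : ∀ t ∈ Finset.Icc 1 T, 0 < b t) (hηb : ∀ t ∈ Finset.Icc 1 T, η t * b t = 1)
    (hmono : ∀ t, b (t - 1) ≤ b t) (k : Fin K) :
    ∑ t ∈ Finset.Icc 1 T, ∑ i, v t i * winProb α (η t • L (t + 1)) i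
      ≤ L (T + 1) k + ∑ t ∈ Finset.Icc 1 T, (b t - b (t - 1)) *
          ∑ i ∈ Finset.univ.erase k, tailConst α * winProb α (η t • L t) i ^ (1 - 1 / α) := by
  have hne : Nonempty (Fin K) := ⟨k⟩
  have htel : ∑ t ∈ Finset.Icc 1 T, (b t - b (t - 1)) = b T := by
    clear hL hb hηb
    induction T with
    | zero => simp [hb0]
    | succ n ih => rw [Finset.sum_Icc_succ_top (by omega), ih]; simp
  set F : (Fin K → ℝ) → ℝ := fun r => ∑ t ∈ Finset.Icc 1 T, ∑ i,
    (winSet (η t • L (t + 1)) i).indicator (fun _ => v t i) r with hF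
  set G : (Fin K → ℝ) → ℝ := fun r => L (T + 1) k + ∑ t ∈ Finset.Icc 1 T, (b t - b (t - 1)) *
    ∑ i ∈ Finset.univ.erase k, (winSet (η t • L t) i).indicator (fun r => r i) r with hG
  have hFint : ∀ t ∈ Finset.Icc 1 T, ∀ i ∈ (Finset.univ : Finset (Fin K)), Integrable (fun r =>
      (winSet (η t • L (t + 1)) i).indicator (fun _ => v t i) r) (paretoPi K α) := fun t _ i _ =>
    (integrable_const _).indicator (measurableSet_winSet _ i)
  have hGint : ∀ t ∈ Finset.Icc 1 T, ∀ i ∈ (Finset.univ.erase k : Finset (Fin K)),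
      Integrable (fun r => (winSet (η t • L t) i).indicator (fun r => r i) r) (paretoPi K α) :=
    fun t _ i _ => (integrable_eval_paretoPi i).indicator (measurableSet_winSet _ i)
  have hGint' : ∀ t ∈ Finset.Icc 1 T, Integrable (fun r => (b t - b (t - 1)) *
      ∑ i ∈ Finset.univ.erase k, (winSet (η t • L t) i).indicator (fun r => r i) r)
      (paretoPi K α) := fun t ht => (integrable_finsetSum _ (hGint t ht)).const_mul _
  have hFG : ∀ᵐ r ∂(paretoPi K α), F r ≤ G r := by
    have h1 : ∀ᵐ r ∂(paretoPi K α), ∀ t i, r ∈ winSet (η t • L t) i → ∀ h : Fin K → ℝ,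
        ∑ k, (winSet (η t • L t) k).indicator (fun _ => h k) r = h i :=
      ae_all_iff.2 fun t => ae_sum_indicator_winSet _
    have h2 : ∀ᵐ r ∂(paretoPi K α), ∀ t i, r ∈ winSet (η t • L (t + 1)) i → ∀ h : Fin K → ℝ,
        ∑ k, (winSet (η t • L (t + 1)) k).indicator (fun _ => h k) r = h i :=
      ae_all_iff.2 fun t => ae_sum_indicator_winSet _
    filter_upwards [h1, h2, ae_one_le_paretoPi] with r hr1 hr2 hr
    choose I hI using fun t => exists_mem_winSet (η t • L t) r
    choose I' hI' using fun t => exists_mem_winSet (η t • L (t + 1)) r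
    have hbtl := sum_be_the_leader_le (r := r) hL1 hL hb0
      (fun t ht => (mem_winSet_smul_iff (hb t ht) (hηb t ht)).1 (hI t))
      (fun t ht => (mem_winSet_smul_iff (hb t ht) (hηb t ht)).1 (hI' t)) k
    have hFe : F r = ∑ t ∈ Finset.Icc 1 T, v t (I' t) :=
      Finset.sum_congr rfl fun t _ => hr2 t _ (hI' t) (v t)
    rw [hFe]
    refine hbtl.trans ?_
    -- The comparator's term `b T * r k` is spread over the rounds. Round `t` then costs `r (I t) -
    -- r k`, which is zero if `I t = k` and otherwise at most `r (I t)`.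
    rw [← htel, Finset.sum_mul, sub_add_eq_add_sub, add_sub_assoc, ← Finset.sum_sub_distrib]
    refine add_le_add le_rfl (Finset.sum_le_sum fun t _ => ?_)
    rw [← mul_sub]
    refine mul_le_mul_of_nonneg_left ?_ (sub_nonneg.2 (hmono t))
    have h3 := hr1 t _ (hI t) fun i => if i = k then 0 else r i
    rw [← Finset.add_sum_erase _ _ (Finset.mem_univ k)] at h3
    simp only [if_pos, Set.indicator_zero, zero_add] at h3
    have h4 : ∑ i ∈ Finset.univ.erase k, (winSet (η t • L t) i).indicator (fun r => r i) r
        = ∑ i ∈ Finset.univ.erase k,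
          (winSet (η t • L t) i).indicator (fun _ => if i = k then 0 else r i) r := by
      refine Finset.sum_congr rfl fun i hi => ?_
      rw [if_neg (Finset.ne_of_mem_erase hi)]
      by_cases h : r ∈ winSet (η t • L t) i
      · rw [Set.indicator_of_mem h, Set.indicator_of_mem h]
      · rw [Set.indicator_of_notMem h, Set.indicator_of_notMem h]
    rw [h4, h3]
    split_ifs with h
    · rw [h]; simp
    · linarith [hr k]
  have hle := integral_mono_ae
    (integrable_finsetSum _ fun t ht => integrable_finsetSum _ (hFint t ht))
    ((integrable_const _).add (integrable_finsetSum _ hGint')) hFG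
  rw [integral_finsetSum _ fun t ht => integrable_finsetSum _ (hFint t ht)] at hle
  simp only [Pi.add_apply] at hle
  rw [integral_add (integrable_const _) (integrable_finsetSum _ hGint'),
    integral_finsetSum _ hGint'] at hle
  calc ∑ t ∈ Finset.Icc 1 T, ∑ i, v t i * winProb α (η t • L (t + 1)) i
      = ∑ t ∈ Finset.Icc 1 T, ∫ r, ∑ i,
          (winSet (η t • L (t + 1)) i).indicator (fun _ => v t i) r ∂(paretoPi K α) := by
        refine Finset.sum_congr rfl fun t ht => ?_
        rw [integral_finsetSum _ (hFint t ht)]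
        refine Finset.sum_congr rfl fun i _ => ?_
        rw [integral_indicator_const _ (measurableSet_winSet _ i), winProb, smul_eq_mul, mul_comm]
    _ ≤ _ := hle
    _ ≤ _ := by
        rw [integral_const, probReal_univ, one_smul]
        refine add_le_add le_rfl (Finset.sum_le_sum fun t ht => ?_)
        rw [integral_const_mul, integral_finsetSum _ (hGint t ht)]
        refine mul_le_mul_of_nonneg_left (Finset.sum_le_sum fun i _ => ?_)
          (sub_nonneg.2 (hmono t))
        rw [integral_indicator (measurableSet_winSet _ i)]
        exact setIntegral_eval_paretoPi_le i _

end BeTheLeader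

/-! ### Summation over the rounds and self-bounding inequalities -/

section SelfBounding

theorem sum_div_sqrt_le {a : ℝ} (ha : 0 ≤ a) (T : ℕ) :
    ∑ t ∈ Finset.Icc 1 T, a / √(t : ℝ) ≤ 2 * a * √(T : ℝ) := by
  induction T with
  | zero => simp
  | succ n ih =>
    rw [Finset.sum_Icc_succ_top (by omega)]
    set x := √(n : ℝ) with hx
    set y := √((n + 1 : ℕ) : ℝ) with hy
    have hx0 : 0 ≤ x := Real.sqrt_nonneg _
    have hy0 : 0 < y := Real.sqrt_pos.2 (by positivity)
    have hxs : x ^ 2 = n := Real.sq_sqrt (Nat.cast_nonneg _)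
    have hys : y ^ 2 = n + 1 := by rw [hy, Real.sq_sqrt (Nat.cast_nonneg _)]; push_cast; ring
    have h1 : 1 / y ≤ 2 * (y - x) := by
      rw [div_le_iff₀ hy0]
      nlinarith [sq_nonneg (y - x)]
    have h2 : a / y = a * (1 / y) := by ring
    nlinarith [mul_le_mul_of_nonneg_left h1 ha]

/-- The crossover is at `t ≈ a ^ 2`: the linear terms sum to `O(a * a)` before it and the cubic ones
to `O(a ^ 3 / a)` after it. -/
theorem sum_min_div_sqrt_le {a : ℝ} (ha : 1 ≤ a) (T : ℕ) :
    ∑ t ∈ Finset.Icc 1 T, min (a / √(t : ℝ)) ((a / √(t : ℝ)) ^ 3) ≤ 6 * a ^ 2 := by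
  have ha0 : 0 < a := by linarith
  have hcoarse : ∀ T : ℕ, ∑ t ∈ Finset.Icc 1 T, min (a / √(t : ℝ)) ((a / √(t : ℝ)) ^ 3)
      ≤ 2 * a * √(T : ℝ) := fun T =>
    (Finset.sum_le_sum fun t _ => min_le_left _ _).trans (sum_div_sqrt_le ha0.le T)
  set n := ⌊a ^ 2⌋₊ with hn
  have hna : (n : ℝ) ≤ a ^ 2 := Nat.floor_le (by positivity)
  have hn1 : 1 ≤ n := Nat.le_floor (by push_cast; nlinarith)
  have hn1' : (1 : ℝ) ≤ n := by exact_mod_cast hn1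
  have hna' : a ^ 2 < n + 1 := Nat.lt_floor_add_one _
  have hsn : √(n : ℝ) ≤ a := Real.sqrt_le_iff.2 ⟨ha0.le, hna⟩
  have hsn' : a / 2 ≤ √(n : ℝ) := Real.le_sqrt_of_sq_le (by nlinarith)
  have hsn0 : 0 < √(n : ℝ) := by linarith
  rcases le_total T n with hT | hT
  · refine (hcoarse T).trans ?_
    have : √(T : ℝ) ≤ a := (Real.sqrt_le_sqrt (by exact_mod_cast hT)).trans hsn
    nlinarith
  -- The subtracted `2 a ^ 3 / √T` bounds the remaining tail of the cubic terms and makes the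
  -- induction close.
  · have key : ∑ t ∈ Finset.Icc 1 T, min (a / √(t : ℝ)) ((a / √(t : ℝ)) ^ 3)
        ≤ 6 * a ^ 2 - 2 * a ^ 3 / √(T : ℝ) := by
      induction T, hT using Nat.le_induction with
      | base =>
        have h1 : 2 * a ^ 3 / √(n : ℝ) ≤ 4 * a ^ 2 := by
          rw [div_le_iff₀ hsn0]
          nlinarith [mul_le_mul_of_nonneg_left hsn' (sq_nonneg a)]
        have h2 := hcoarse n
        nlinarith
      | succ m hm ih =>
        rw [Finset.sum_Icc_succ_top (by omega)]
        have hm1 : (1 : ℝ) ≤ m := by exact_mod_cast hn1.trans hm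
        set x := √(m : ℝ) with hx
        set y := √((m + 1 : ℕ) : ℝ) with hy
        have hx0 : 0 < x := Real.sqrt_pos.2 (by linarith)
        have hy0 : 0 < y := Real.sqrt_pos.2 (by positivity)
        have hxs : x ^ 2 = m := Real.sq_sqrt (Nat.cast_nonneg _)
        have hys : y ^ 2 = x ^ 2 + 1 := by
          rw [hxs, hy, Real.sq_sqrt (Nat.cast_nonneg _)]; push_cast; ring
        have hxy : x ≤ y := by
          by_contra! h
          nlinarith
        have h1 : min (a / y) ((a / y) ^ 3) ≤ (a / y) ^ 3 := min_le_right _ _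
        have h2 : (a / y) ^ 3 ≤ 2 * a ^ 3 / x - 2 * a ^ 3 / y := by
          have e : 2 * a ^ 3 / x - 2 * a ^ 3 / y = (a / y) ^ 3 * (2 * y ^ 2 * (y - x) / x) := by
            field_simp
          rw [e]
          refine le_mul_of_one_le_right (by positivity) ?_
          rw [le_div_iff₀ hx0]
          have h3 : (y - x) * (y + x) = 1 := by linear_combination hys
          have h4 : 0 ≤ y - x := by linarith
          have h5 : 1 ≤ (y - x) * (2 * y) := by nlinarith
          nlinarith
        linarith
    have : 0 ≤ 2 * a ^ 3 / √(T : ℝ) := by positivity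
    linarith

/-- If the left side exceeds `Δ w / 4`, then `w ^ (1/α) ≤ 4 A / Δ`, and substituting this for `w`
leaves only the second term. -/
theorem mul_rpow_le_self_bounding {α A Δ w : ℝ} (hα : 1 < α) (hA : 0 ≤ A) (hΔ : 0 < Δ)
    (hw : 0 ≤ w) :
    A * w ^ (1 - 1 / α) ≤ Δ * w / 4 + 4 ^ (α - 1) * (A ^ α * Δ ^ (1 - α)) := by
  have hα0 : 0 < α := by linarith
  have hnn : 0 ≤ 4 ^ (α - 1) * (A ^ α * Δ ^ (1 - α)) := by positivity
  rcases le_or_gt (A * w ^ (1 - 1 / α)) (Δ * w / 4) with h | h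
  · linarith
  have hw0 : 0 < w := by
    refine hw.lt_of_ne fun h0 => ?_
    have : 0 < 1 - 1 / α := by rw [sub_pos, div_lt_one hα0]; exact hα
    rw [← h0, Real.zero_rpow this.ne'] at h
    simp at h
  have hA0 : 0 < A := by
    refine hA.lt_of_ne fun h0 => ?_
    rw [← h0, zero_mul] at h
    have := mul_pos hΔ hw0
    linarith
  have hsplit : w = w ^ (1 - 1 / α) * w ^ (1 / α) := by
    rw [← Real.rpow_add hw0, sub_add_cancel, Real.rpow_one]
  have hp : 0 < w ^ (1 - 1 / α) := Real.rpow_pos_of_pos hw0 _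
  have h1 : w ^ (1 / α) ≤ 4 * A / Δ := by
    rw [le_div_iff₀ hΔ]
    have h0 : Δ * w / 4 = Δ * (w ^ (1 - 1 / α) * w ^ (1 / α)) / 4 := by rw [← hsplit]
    rw [h0] at h
    by_contra! h2
    have := mul_lt_mul_of_pos_left h2 hp
    linarith
  have h2 : w ^ (1 - 1 / α) ≤ (4 * A / Δ) ^ (α - 1) := by
    have := Real.rpow_le_rpow (by positivity) h1 (by linarith : 0 ≤ α - 1)
    rw [← Real.rpow_mul hw0.le] at this
    convert this using 2
    field_simp
  calc A * w ^ (1 - 1 / α) ≤ A * (4 * A / Δ) ^ (α - 1) := by gcongr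
    _ = 4 ^ (α - 1) * (A ^ α * Δ ^ (1 - α)) := by
        rw [Real.div_rpow (by positivity) hΔ.le, Real.mul_rpow (by norm_num) hA0.le,
          show A ^ α = A ^ (α - 1) * A by
            nth_rewrite 3 [← Real.rpow_one A]; rw [← Real.rpow_add hA0]; simp,
          show (1 - α) = -(α - 1) by ring, Real.rpow_neg hΔ.le]
        field_simp
    _ ≤ _ := le_add_of_nonneg_left (by positivity)

theorem sqrt_sub_sqrt_pred_le (t : ℕ) : √(t : ℝ) - √((t - 1 : ℕ) : ℝ) ≤ 1 / √(t : ℝ) := by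
  rcases t with _ | n
  · simp
  · rw [Nat.add_sub_cancel]
    have hy0 : 0 < √((n + 1 : ℕ) : ℝ) := Real.sqrt_pos.2 (by positivity)
    have hx0 : 0 ≤ √(n : ℝ) := Real.sqrt_nonneg _
    have hxs : √(n : ℝ) ^ 2 = n := Real.sq_sqrt (Nat.cast_nonneg _)
    have hys : √((n + 1 : ℕ) : ℝ) ^ 2 = n + 1 := by
      rw [Real.sq_sqrt (Nat.cast_nonneg _)]; push_cast; ring
    have hxy : √(n : ℝ) ≤ √((n + 1 : ℕ) : ℝ) := Real.sqrt_le_sqrt (by push_cast; linarith)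
    rw [le_div_iff₀ hy0]
    nlinarith

/-- The inverse of the learning rate `c * K ^ (1 / α - 1 / 2) / √t`. -/
noncomputable def invRate (α c : ℝ) (K t : ℕ) : ℝ := √(t : ℝ) * (K : ℝ) ^ (1 / 2 - 1 / α) / c

theorem invRate_zero (α c : ℝ) (K : ℕ) : invRate α c K 0 = 0 := by simp [invRate]

theorem invRate_pos {α c : ℝ} {K t : ℕ} (hc : 0 < c) (hK : 0 < K) (ht : 0 < t) :
    0 < invRate α c K t := by
  have : (0 : ℝ) < K := by exact_mod_cast hK
  have : (0 : ℝ) < t := by exact_mod_cast ht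
  unfold invRate; positivity

theorem rate_mul_invRate {α c : ℝ} {K t : ℕ} (hc : 0 < c) (hK : 0 < K) (ht : 0 < t) :
    c * (K : ℝ) ^ (1 / α - 1 / 2) / √(t : ℝ) * invRate α c K t = 1 := by
  have hK' : (0 : ℝ) < K := by exact_mod_cast hK
  have ht' : 0 < √(t : ℝ) := Real.sqrt_pos.2 (by exact_mod_cast ht)
  have h : (K : ℝ) ^ (1 / α - 1 / 2) * (K : ℝ) ^ (1 / 2 - 1 / α) = 1 := by
    rw [← Real.rpow_add hK']; simp
  rw [invRate]
  generalize (K : ℝ) ^ (1 / α - 1 / 2) = x at *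
  generalize (K : ℝ) ^ (1 / 2 - 1 / α) = y at *
  field_simp
  exact h

theorem invRate_mono {α c : ℝ} (hc : 0 < c) (K : ℕ) : Monotone (invRate α c K) := fun s t h => by
  have : √(s : ℝ) ≤ √(t : ℝ) := Real.sqrt_le_sqrt (by exact_mod_cast h)
  unfold invRate; gcongr

theorem invRate_sub_mul_le {α c : ℝ} (hα : 1 < α) (hα3 : α ≤ 3) (hc : 0 < c) {K t : ℕ} (hK : 0 < K)
    {Δ w : ℝ} (hΔ : 0 < Δ) (hw : 0 ≤ w) :
    (invRate α c K t - invRate α c K (t - 1)) * (tailConst α * w ^ (1 - 1 / α))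
      ≤ Δ * w / 4 + 4 ^ (α - 1) * (tailConst α / c) ^ α *
          (√(K : ℝ) * Δ ^ (1 - α) * (t : ℝ) ^ (-α / 2)) := by
  have hα0 : 0 < α := by linarith
  have hα' : 0 < α - 1 := by linarith
  have htc : 0 < tailConst α := by unfold tailConst; positivity
  have hK' : (1 : ℝ) ≤ K := by exact_mod_cast hK
  have hK0 : (0 : ℝ) < K := by linarith
  set k := (K : ℝ) ^ (1 / 2 - 1 / α) with hk
  have hk0 : 0 < k := by positivity
  set A := tailConst α / c * k * (1 / √(t : ℝ)) with hA
  have hA0 : 0 ≤ A := by positivity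
  have h1 : (invRate α c K t - invRate α c K (t - 1)) * (tailConst α * w ^ (1 - 1 / α))
      ≤ A * w ^ (1 - 1 / α) := by
    have e : (invRate α c K t - invRate α c K (t - 1)) * (tailConst α * w ^ (1 - 1 / α))
        = tailConst α / c * k * (√(t : ℝ) - √((t - 1 : ℕ) : ℝ)) * w ^ (1 - 1 / α) := by
      rw [invRate, invRate, ← hk]; ring
    rw [e, hA]
    gcongr
    exact sqrt_sub_sqrt_pred_le t
  refine h1.trans ((mul_rpow_le_self_bounding hα hA0 hΔ hw).trans ?_)
  have hAα : A ^ α ≤ (tailConst α / c) ^ α * (√(K : ℝ) * (t : ℝ) ^ (-α / 2)) := by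
    rw [hA, Real.mul_rpow (by positivity) (by positivity),
      Real.mul_rpow (by positivity) (by positivity), mul_assoc]
    have e1 : (1 / √(t : ℝ)) ^ α = (t : ℝ) ^ (-α / 2) := by
      rw [Real.sqrt_eq_rpow, one_div, Real.inv_rpow (by positivity),
        ← Real.rpow_mul (Nat.cast_nonneg t), ← Real.rpow_neg (Nat.cast_nonneg t)]
      congr 1; ring
    -- `k ^ α = K ^ (α/2 - 1)`, and `α/2 - 1 ≤ 1/2` is again `α ≤ 3`.
    have e2 : k ^ α ≤ √(K : ℝ) := by
      rw [hk, ← Real.rpow_mul hK0.le, Real.sqrt_eq_rpow]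
      refine Real.rpow_le_rpow_of_exponent_le hK' ?_
      rw [sub_mul, one_div_mul_cancel hα0.ne']; linarith
    rw [e1]; gcongr
  calc Δ * w / 4 + 4 ^ (α - 1) * (A ^ α * Δ ^ (1 - α))
      ≤ Δ * w / 4 + 4 ^ (α - 1) *
        ((tailConst α / c) ^ α * (√(K : ℝ) * (t : ℝ) ^ (-α / 2)) * Δ ^ (1 - α)) := by gcongr
    _ = _ := by ring

end SelfBounding

/-! ### Measurability and lower bounds of the exploration probabilities -/

section ExploreProb

variable {K : ℕ} {α η : ℝ}

theorem measurable_exploreWeight {X : Type*} {mX : MeasurableSpace X} {L : X → Fin K → ℝ}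
    {σ : X → Fin K → ℕ} (hL : Measurable L) (hσ : Measurable σ) (i : Fin K) :
    Measurable fun x => exploreWeight α η (L x) (σ x) i := by
  have h1 : ∀ k, Measurable fun x => L x k := fun k => (measurable_pi_apply k).comp hL
  have h2 : Measurable fun x => lossGap (L x) i := (h1 i).sub (Measurable.iInf h1)
  have h3 : Measurable fun x => (σ x i : ℝ) :=
    (measurable_from_top (f := fun n : ℕ => (n : ℝ))).comp ((measurable_pi_apply i).comp hσ)
  unfold exploreWeight
  fun_prop

theorem measurable_exploreProb {X : Type*} {mX : MeasurableSpace X} {L : X → Fin K → ℝ}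
    {σ : X → Fin K → ℕ} (hL : Measurable L) (hσ : Measurable σ) (i : Fin K) :
    Measurable fun x => exploreProb α η (L x) (σ x) i :=
  (measurable_exploreWeight hL hσ i).div
    (Finset.measurable_fun_sum _ fun j _ => measurable_exploreWeight hL hσ j)

/-- A qualitative bound: it keeps the importance-weighted estimates bounded, hence integrable, and
does not enter the final constant. -/
theorem exists_le_exploreProb (hα : 0 < α) (hη : 0 ≤ η) (B : ℝ) :
    ∃ p > 0, ∀ (L : Fin K → ℝ) (σ : Fin K → ℕ), (∀ i, |L i| ≤ B) → IsRanking L σ →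
      ∀ i, p ≤ exploreProb α η L σ i := by
  rcases isEmpty_or_nonempty (Fin K) with hK | ⟨⟨i₀⟩⟩
  · exact ⟨1, one_pos, fun L σ _ _ i => (hK.false i).elim⟩
  have hK : (0 : ℝ) < K := by exact_mod_cast i₀.pos
  set q := (min (1 / (1 + η * (2 * |B|))) (1 / (K : ℝ) ^ (1 / α))) ^ ((α + 1) / 2) with hq
  have hq0 : 0 < q := Real.rpow_pos_of_pos (lt_min (by positivity) (by positivity)) _
  refine ⟨q / K, by positivity, fun L σ hB hσ i => ?_⟩
  have hne : Nonempty (Fin K) := ⟨i⟩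
  have hgap : ∀ j, 0 ≤ η * lossGap L j := fun j => mul_nonneg hη (lossGap_nonneg L j)
  have hσ1 : ∀ j, (1 : ℝ) ≤ σ j := fun j => by exact_mod_cast hσ.one_le j
  have hle : ∀ j, exploreWeight α η L σ j ≤ 1 := fun j => by
    refine (exploreWeight_le_rank hη hα j).trans ?_
    exact Real.rpow_le_one_of_one_le_of_nonpos (hσ1 j) (by rw [neg_nonpos]; positivity)
  have hsum : ∑ j, exploreWeight α η L σ j ≤ K := by
    refine (Finset.sum_le_sum fun j _ => hle j).trans (by simp)
  refine div_le_div₀ (exploreWeight_pos hη hσ i).le ?_ (sum_exploreWeight_pos hη hσ) hsum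
  refine Real.rpow_le_rpow (le_min (by positivity) (by positivity)) ?_ (by positivity)
  refine min_le_min (one_div_le_one_div_of_le (by linarith [hgap i]) ?_)
    (one_div_le_one_div_of_le (by have := hσ1 i; positivity) ?_)
  · obtain ⟨k, hk⟩ := exists_lossGap_eq L i
    rw [hk]
    gcongr
    have h1 := abs_le.1 (hB i)
    have h2 := abs_le.1 (hB k)
    linarith [le_abs_self B]
  · refine Real.rpow_le_rpow (Nat.cast_nonneg _) ?_ (by positivity)
    exact_mod_cast (hσ.1.mapsTo (Set.mem_univ i)).2

end ExploreProb

/-! ### Conditional expectations along a run -/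

namespace FTPLRun

variable {Ω : Type*} [mΩ : MeasurableSpace Ω] {P : Measure Ω} {K T : ℕ} {α : ℝ} {η : ℕ → ℝ}

/-- The exploration probability of the arm `i` in round `t`. -/
noncomputable def prob (R : FTPLRun P K T α η) (t : ℕ) (ω : Ω) (i : Fin K) : ℝ :=
  exploreProb α (η t) (R.lhat t ω) (R.rank t ω) i

/-- The importance-weighted estimate of the loss vector of round `t`. -/
noncomputable def estimate (R : FTPLRun P K T α η) (t : ℕ) (ω : Ω) : Fin K → ℝ :=
  Pi.single (R.explore t ω) (R.loss t ω (R.explore t ω) / R.prob t ω (R.explore t ω))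

/-- The probability, given the past, that fresh Pareto perturbations make the arm `i` the leader
of round `t`. -/
noncomputable def win (R : FTPLRun P K T α η) (t : ℕ) (ω : Ω) (i : Fin K) : ℝ :=
  winProb α (η t • R.lhat t ω) i

/-- The information on the past and on the losses of round `t`. -/
@[reducible]
def pastLoss (R : FTPLRun P K T α η) (t : ℕ) : MeasurableSpace Ω :=
  R.history t ⊔ MeasurableSpace.comap (R.loss t) inferInstance

/-- The information on the past and on the losses and the perturbations of round `t`. -/
@[reducible]
def pastLossPert (R : FTPLRun P K T α η) (t : ℕ) : MeasurableSpace Ω :=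
  R.history t ⊔ MeasurableSpace.comap (R.loss t) inferInstance ⊔
    MeasurableSpace.comap (R.pert t) inferInstance

variable (R : FTPLRun P K T α η)

theorem history_le_pastLoss (t : ℕ) : R.history t ≤ R.pastLoss t := le_sup_left

theorem measurable_loss_pastLoss (t : ℕ) : Measurable[R.pastLoss t] (R.loss t) :=
  (comap_measurable (R.loss t)).mono le_sup_right le_rfl

theorem lhat_succ' {t : ℕ} (ht : t ∈ Finset.Icc 1 T) (ω : Ω) :
    R.lhat (t + 1) ω = R.lhat t ω + R.estimate t ω := R.lhat_succ t ht ω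

theorem estimate_apply (t : ℕ) (ω : Ω) (i : Fin K) :
    R.estimate t ω i
      = (R.explore t ⁻¹' {i}).indicator (fun ω => R.loss t ω i / R.prob t ω i) ω := by
  by_cases h : R.explore t ω = i
  · rw [Set.indicator_of_mem (by simpa using h), estimate, h, Pi.single_eq_same]
  · rw [Set.indicator_of_notMem (by simpa using h), estimate, Pi.single_eq_of_ne (Ne.symm h)]

theorem measurable_lhat {t : ℕ} (ht1 : 1 ≤ t) (htT : t ≤ T + 1) :
    Measurable[R.history t] (R.lhat t) := by
  induction t, ht1 using Nat.le_induction with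
  | base =>
    have : R.lhat 1 = fun _ => 0 := funext R.lhat_one
    rw [this]
    exact measurable_const
  | succ t ht ih =>
    have htm : t ∈ Finset.Icc 1 T := Finset.mem_Icc.2 ⟨ht, by omega⟩
    have hmono : R.history t ≤ R.history (t + 1) := R.history.mono (Nat.le_succ t)
    have h1 : Measurable[R.history (t + 1)] (R.lhat t) := (ih (by omega)).mono hmono le_rfl
    have h2 : Measurable[R.history (t + 1)] (R.rank t) :=
      (R.measurable_rank t htm).mono hmono le_rfl
    refine @measurable_pi_lambda _ _ _ (R.history (t + 1)) _ _ fun i => ?_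
    have e : (fun ω => R.lhat (t + 1) ω i) = fun ω => R.lhat t ω i +
        (R.explore t ⁻¹' {i}).indicator
          (fun ω => R.loss t ω (R.explore t ω) / R.prob t ω i) ω := by
      funext ω
      rw [R.lhat_succ' htm, Pi.add_apply, R.estimate_apply]
      congr 1
      by_cases h : R.explore t ω = i
      · rw [Set.indicator_of_mem (by simpa using h), Set.indicator_of_mem (by simpa using h), h]
      · rw [Set.indicator_of_notMem (by simpa using h), Set.indicator_of_notMem (by simpa using h)]
    rw [e]
    refine Measurable.add ((measurable_pi_apply i).comp h1) ?_
    refine Measurable.indicator ?_ (R.measurable_explore t htm (measurableSet_singleton i))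
    exact (R.measurable_observed t htm).div (measurable_exploreProb h1 h2 i)

theorem measurable_prob {t : ℕ} (ht : t ∈ Finset.Icc 1 T) (i : Fin K) :
    Measurable[R.history t] fun ω => R.prob t ω i := by
  obtain ⟨h1, h2⟩ := Finset.mem_Icc.1 ht
  exact measurable_exploreProb (R.measurable_lhat h1 (by omega)) (R.measurable_rank t ht) i

theorem measurable_win [Fact (1 < α)] {t : ℕ} (ht : t ∈ Finset.Icc 1 T) (i : Fin K) :
    Measurable[R.history t] fun ω => R.win t ω i := by
  obtain ⟨h1, h2⟩ := Finset.mem_Icc.1 ht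
  exact (measurable_winProb i).comp ((measurable_const_smul (η t)).comp
    (R.measurable_lhat h1 (by omega)))

theorem exists_le_prob (hα : 0 < α) (hη : ∀ t ∈ Finset.Icc 1 T, 0 < η t) {t : ℕ}
    (ht : t ∈ Finset.Icc 1 T) : ∃ p > 0, ∀ ω i, p ≤ R.prob t ω i := by
  -- The estimates are bounded surely, round by round: a bound for one round bounds its exploration
  -- probabilities from below, hence the next increment.
  have key : ∀ t, 1 ≤ t → t ≤ T → ∃ B : ℝ, ∀ ω i, |R.lhat t ω i| ≤ B := by
    intro t ht1
    induction t, ht1 using Nat.le_induction with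
    | base => exact fun _ => ⟨0, fun ω i => by simp [R.lhat_one]⟩
    | succ t ht1 ih =>
      intro htT
      obtain ⟨B, hB⟩ := ih (by omega)
      have htm : t ∈ Finset.Icc 1 T := Finset.mem_Icc.2 ⟨ht1, by omega⟩
      obtain ⟨p, hp, hpB⟩ := exists_le_exploreProb (K := K) hα (hη t htm).le B
      refine ⟨B + 1 / p, fun ω i => ?_⟩
      have hpi : p ≤ R.prob t ω i := hpB _ _ (hB ω) (R.isRanking t htm ω) i
      rw [R.lhat_succ' htm, Pi.add_apply]
      refine (abs_add_le _ _).trans (add_le_add (hB ω i) ?_)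
      rw [R.estimate_apply]
      obtain ⟨h0, h1⟩ := R.loss_mem t htm ω i
      by_cases h : ω ∈ R.explore t ⁻¹' {i}
      · rw [Set.indicator_of_mem h, abs_of_nonneg (div_nonneg h0 (hp.le.trans hpi))]
        exact div_le_div₀ zero_le_one h1 hp hpi
      · rw [Set.indicator_of_notMem h, abs_zero]; positivity
  obtain ⟨h1, h2⟩ := Finset.mem_Icc.1 ht
  obtain ⟨B, hB⟩ := key t h1 h2
  obtain ⟨p, hp, hpB⟩ := exists_le_exploreProb (K := K) hα (hη t ht).le B
  exact ⟨p, hp, fun ω i => hpB _ _ (hB ω) (R.isRanking t ht ω) i⟩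

theorem pastLoss_le {t : ℕ} (ht : t ∈ Finset.Icc 1 T) : R.pastLoss t ≤ mΩ :=
  sup_le (R.history.le t) (R.measurable_loss t ht).comap_le

theorem measurable_pert' {t : ℕ} (ht : t ∈ Finset.Icc 1 T) : Measurable (R.pert t) :=
  (R.measurable_pert t ht).mono (R.history.le _) le_rfl

theorem measurable_explore' {t : ℕ} (ht : t ∈ Finset.Icc 1 T) : Measurable (R.explore t) :=
  (R.measurable_explore t ht).mono (R.history.le _) le_rfl

theorem measurable_exploit' {t : ℕ} (ht : t ∈ Finset.Icc 1 T) : Measurable (R.exploit t) :=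
  (R.measurable_exploit t ht).mono (R.history.le _) le_rfl

variable [IsProbabilityMeasure P]

theorem integral_indicator_explore {t : ℕ} (ht : t ∈ Finset.Icc 1 T) (i : Fin K) {Y : Ω → ℝ}
    (hY : Measurable[R.pastLoss t] Y) {B : ℝ} (hB : ∀ ω, |Y ω| ≤ B) :
    ∫ ω, (R.explore t ⁻¹' {i}).indicator Y ω ∂P = ∫ ω, R.prob t ω i * Y ω ∂P := by
  have hmΩ : R.pastLossPert t ≤ mΩ := sup_le (R.pastLoss_le ht) (R.measurable_pert' ht).comap_le
  have hS : MeasurableSet (R.explore t ⁻¹' {i}) :=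
    R.measurable_explore' ht (measurableSet_singleton i)
  have hYm : StronglyMeasurable[R.pastLossPert t] Y := (hY.mono (le_sup_left : R.pastLoss t ≤ R.pastLossPert t) le_rfl).stronglyMeasurable
  have hYint : Integrable Y P := Integrable.of_bound (hYm.mono hmΩ).aestronglyMeasurable B
    (ae_of_all _ hB)
  have e : (R.explore t ⁻¹' {i}).indicator Y
      = Y * (R.explore t ⁻¹' {i}).indicator fun _ => (1 : ℝ) := by
    funext ω
    by_cases h : ω ∈ R.explore t ⁻¹' {i} <;> simp [Set.indicator, h]
  have h1 := condExp_mul_of_stronglyMeasurable_left (μ := P) hYm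
    (e ▸ hYint.indicator hS) ((integrable_const (1 : ℝ)).indicator hS)
  rw [← integral_condExp hmΩ, e]
  refine integral_congr_ae ?_
  filter_upwards [h1, R.condExp_explore t ht i] with ω hω1 hω2
  rw [hω1, Pi.mul_apply, hω2, mul_comm]; rfl

theorem integral_loss_mul [Fact (1 < α)] {t : ℕ}
    (ht : t ∈ Finset.Icc 1 T) {i : Fin K} {p : ℝ} (hp : 0 < p) (hpi : ∀ ω, p ≤ R.prob t ω i)
    {Z : Ω → ℝ} (hZ : Measurable[R.pastLoss t] Z) {B : ℝ} (hB : ∀ ω, |Z ω| ≤ B) :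
    ∫ ω, (R.explore t ⁻¹' {i}).indicator (fun ω => R.loss t ω i / R.prob t ω i * Z ω) ω ∂P
      = ∫ ω, R.loss t ω i * Z ω ∂P := by
  have hℓ : Measurable[R.pastLoss t] fun ω => R.loss t ω i :=
    (measurable_pi_apply i).comp (R.measurable_loss_pastLoss t)
  have hprob : Measurable[R.pastLoss t] fun ω => R.prob t ω i :=
    (R.measurable_prob ht i).mono (R.history_le_pastLoss t) le_rfl
  have hY : Measurable[R.pastLoss t] fun ω => R.loss t ω i / R.prob t ω i * Z ω :=
    (hℓ.div hprob).mul hZ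
  rw [R.integral_indicator_explore ht i hY (B := 1 / p * B)]
  · refine integral_congr_ae (ae_of_all _ fun ω => ?_)
    have : R.prob t ω i ≠ 0 := (hp.trans_le (hpi ω)).ne'
    simp only
    field_simp
  · intro ω
    obtain ⟨h0, h1⟩ := R.loss_mem t ht ω i
    rw [abs_mul, abs_of_nonneg (div_nonneg h0 (hp.le.trans (hpi ω)))]
    exact mul_le_mul (div_le_div₀ zero_le_one h1 hp (hpi ω)) (hB ω) (abs_nonneg _) (by positivity)

/-- The perturbations are independent of the past and of the current losses, so Fubini integrates
them out. Only an inequality is needed: an exploited arm lies in its `winSet` whatever the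
tie-breaking, and losses are nonnegative. -/
theorem integral_loss_indicator_exploit_le [Fact (1 < α)] {t : ℕ} (ht : t ∈ Finset.Icc 1 T)
    (hη : 0 < η t) (i : Fin K) :
    ∫ ω, (R.exploit t ⁻¹' {i}).indicator (fun ω => R.loss t ω i) ω ∂P
      ≤ ∫ ω, R.loss t ω i * R.win t ω i ∂P := by
  obtain ⟨ht1, htT⟩ := Finset.mem_Icc.1 ht
  have hℓ : Measurable[R.pastLoss t] fun ω => R.loss t ω i :=
    (measurable_pi_apply i).comp (R.measurable_loss_pastLoss t)
  have hL : Measurable[R.pastLoss t] (R.lhat t) :=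
    (R.measurable_lhat ht1 (by omega)).mono (R.history_le_pastLoss t) le_rfl
  set Y : Ω → ℝ × (Fin K → ℝ) := fun ω => (R.loss t ω i, R.lhat t ω) with hY
  have hYm : Measurable[R.pastLoss t] Y := hℓ.prodMk hL
  have hYm' : Measurable Y := hYm.mono (R.pastLoss_le ht) le_rfl
  have hX := R.measurable_pert' ht
  have hind : IndepFun Y (R.pert t) P := by
    have h1 := (R.indep_pert t ht).symm
    rw [IndepFun_iff_Indep]
    exact indep_of_indep_of_le_left h1 hYm.comap_le
  have hmap := (indepFun_iff_map_prod_eq_prod_map_map hYm'.aemeasurable hX.aemeasurable).1 hind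
  rw [R.map_pert t ht] at hmap
  set S : Set ((ℝ × (Fin K → ℝ)) × (Fin K → ℝ)) := {x | x.2 ∈ winSet (η t • x.1.2) i} with hS
  have hSm : MeasurableSet S := by
    have : S = ⋂ k, {x | (η t • x.1.2) i - x.2 i ≤ (η t • x.1.2) k - x.2 k} := by
      ext x; simp [hS, winSet]
    rw [this]
    refine MeasurableSet.iInter fun k => measurableSet_le ?_ ?_ <;>
    · simp only [Pi.smul_apply, smul_eq_mul]; fun_prop
  set f : (ℝ × (Fin K → ℝ)) × (Fin K → ℝ) → ℝ := S.indicator fun x => x.1.1 with hf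
  have hfm : Measurable f := (measurable_fst.comp measurable_fst).indicator hSm
  have hfint : Integrable (fun ω => f (Y ω, R.pert t ω)) P := by
    refine Integrable.of_bound (hfm.comp (hYm'.prodMk hX)).aestronglyMeasurable 1
      (ae_of_all _ fun ω => ?_)
    obtain ⟨h0, h1⟩ := R.loss_mem t ht ω i
    refine (norm_indicator_le_norm_self _ _).trans ?_
    rw [Real.norm_of_nonneg h0]; exact h1
  have hfint' : Integrable f ((P.map Y).prod (paretoPi K α)) := by
    rw [← hmap]
    exact (integrable_map_measure hfm.aestronglyMeasurable (hYm'.prodMk hX).aemeasurable).2 hfint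
  have hle : ∀ ω, (R.exploit t ⁻¹' {i}).indicator (fun ω => R.loss t ω i) ω
      ≤ f (Y ω, R.pert t ω) := by
    intro ω
    have h0 := (R.loss_mem t ht ω i).1
    by_cases h : R.exploit t ω = i
    · rw [Set.indicator_of_mem (by simpa using h)]
      have hmem : (Y ω, R.pert t ω) ∈ S := by
        intro k
        have h1 := R.exploit_argmin t ht ω k
        rw [h] at h1
        have h2 := mul_le_mul_of_nonneg_left h1 hη.le
        simp only [mul_sub, mul_div_cancel₀ _ hη.ne'] at h2
        simpa [hY] using h2
      rw [hf, Set.indicator_of_mem hmem]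
    · rw [Set.indicator_of_notMem (by simpa using h)]
      exact Set.indicator_apply_nonneg fun _ => h0
  calc ∫ ω, (R.exploit t ⁻¹' {i}).indicator (fun ω => R.loss t ω i) ω ∂P
      ≤ ∫ ω, f (Y ω, R.pert t ω) ∂P := by
        refine integral_mono_of_nonneg (ae_of_all _ fun ω => ?_) hfint (ae_of_all _ hle)
        exact Set.indicator_apply_nonneg fun _ => (R.loss_mem t ht ω i).1
    _ = ∫ x, f x ∂((P.map Y).prod (paretoPi K α)) := by
        rw [← hmap, integral_map (hYm'.prodMk hX).aemeasurable hfm.aestronglyMeasurable]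
    _ = ∫ y, ∫ r, f (y, r) ∂(paretoPi K α) ∂(P.map Y) := integral_prod _ hfint'
    _ = ∫ y, y.1 * winProb α (η t • y.2) i ∂(P.map Y) := by
        refine integral_congr_ae (ae_of_all _ fun y => ?_)
        have : (fun r => f (y, r)) = (winSet (η t • y.2) i).indicator fun _ => y.1 := rfl
        simp only
        rw [this, integral_indicator_const _ (measurableSet_winSet _ i), winProb, smul_eq_mul,
          mul_comm]
    _ = ∫ ω, R.loss t ω i * R.win t ω i ∂P := by
        rw [integral_map hYm'.aemeasurable]
        · rfl
        · refine Measurable.aestronglyMeasurable ?_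
          exact measurable_fst.mul ((measurable_winProb i).comp
            ((measurable_const_smul (η t)).comp measurable_snd))

/-- The winning probability is determined by the history and factors out of the conditional
expectation, leaving the constant `Δ i k`. -/
theorem integral_loss_sub_mul_win [Fact (1 < α)] {Δ : Fin K → Fin K → ℝ}
    (hΔ : R.IsStochasticallyConstrained Δ) {t : ℕ} (ht : t ∈ Finset.Icc 1 T) (i k : Fin K) :
    ∫ ω, R.win t ω i * (R.loss t ω i - R.loss t ω k) ∂P = Δ i k * ∫ ω, R.win t ω i ∂P := by
  have hℓ : ∀ j, Measurable fun ω => R.loss t ω j := fun j =>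
    (measurable_pi_apply j).comp (R.measurable_loss t ht)
  have hint : Integrable (fun ω => R.loss t ω i - R.loss t ω k) P := by
    refine Integrable.of_bound ((hℓ i).sub (hℓ k)).aestronglyMeasurable 1 (ae_of_all _ fun ω => ?_)
    obtain ⟨h0, h1⟩ := R.loss_mem t ht ω i
    obtain ⟨h2, h3⟩ := R.loss_mem t ht ω k
    rw [Real.norm_eq_abs, abs_le]; constructor <;> linarith
  have hw := (R.measurable_win ht i).stronglyMeasurable
  have hw' : ∀ ω, ‖R.win t ω i‖ ≤ 1 := fun ω => by
    exact (Real.norm_of_nonneg (winProb_nonneg _ _)).trans_le (winProb_le_one _ _)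
  have h1 := condExp_mul_of_stronglyMeasurable_left (μ := P) hw
    (hint.bdd_mul (hw.mono (R.history.le t)).aestronglyMeasurable (ae_of_all _ hw')) hint
  have h2 := integral_condExp (μ := P) (f := (fun ω => R.win t ω i) *
    fun ω => R.loss t ω i - R.loss t ω k) (R.history.le t)
  change _ = ∫ ω, R.win t ω i * (R.loss t ω i - R.loss t ω k) ∂P at h2
  rw [← h2, ← integral_const_mul]
  refine integral_congr_ae ?_
  filter_upwards [h1, hΔ t ht i k] with ω hω1 hω2
  rw [hω1, Pi.mul_apply, hω2, mul_comm]

end FTPLRun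

theorem measurable_winProb_add_single {K : ℕ} {α : ℝ} [Fact (1 < α)] {X : Type*}
    {mX : MeasurableSpace X} {lam : X → Fin K → ℝ} {x : X → ℝ} (hlam : Measurable lam)
    (hx : Measurable x) (i : Fin K) :
    Measurable fun ω => winProb α (lam ω + Pi.single i (x ω)) i := by
  have hs : Measurable fun y : ℝ => (Pi.single i y : Fin K → ℝ) := (continuous_single i).measurable
  exact (measurable_winProb i).comp (hlam.add (hs.comp hx))

/-! ### Decomposition of the regret into stability and penalty -/

namespace FTPLRun

variable {Ω : Type*} [mΩ : MeasurableSpace Ω] {P : Measure Ω} {K T : ℕ} {α : ℝ} {η : ℕ → ℝ}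
  (R : FTPLRun P K T α η)

theorem measurable_loss_apply {t : ℕ} (ht : t ∈ Finset.Icc 1 T) (i : Fin K) :
    Measurable fun ω => R.loss t ω i :=
  (measurable_pi_apply i).comp (R.measurable_loss t ht)

theorem abs_loss_le {t : ℕ} (ht : t ∈ Finset.Icc 1 T) (ω : Ω) (i : Fin K) :
    |R.loss t ω i| ≤ 1 := by
  obtain ⟨h0, h1⟩ := R.loss_mem t ht ω i
  rwa [abs_of_nonneg h0]

theorem lhat_apply_eq_sum_estimate {n : ℕ} (hn : n ≤ T) (ω : Ω) :
    R.lhat (n + 1) ω = ∑ t ∈ Finset.Icc 1 n, R.estimate t ω := by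
  induction n with
  | zero => simp [R.lhat_one]
  | succ n ih =>
    rw [Finset.sum_Icc_succ_top (by omega), ← ih (by omega)]
    exact R.lhat_succ' (Finset.mem_Icc.2 ⟨by omega, hn⟩) ω

theorem measurable_smul_lhat {t : ℕ} (ht : t ∈ Finset.Icc 1 T) :
    Measurable[R.history t] fun ω => η t • R.lhat t ω := by
  obtain ⟨h1, h2⟩ := Finset.mem_Icc.1 ht
  exact (measurable_const_smul (η t)).comp (R.measurable_lhat h1 (by omega))

theorem integrable_loss_apply [IsProbabilityMeasure P] {t : ℕ} (ht : t ∈ Finset.Icc 1 T) (i : Fin K) :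
    Integrable (fun ω => R.loss t ω i) P :=
  Integrable.of_bound (R.measurable_loss_apply ht i).aestronglyMeasurable 1
    (ae_of_all _ fun ω => R.abs_loss_le ht ω i)

theorem integral_loss_sub [IsProbabilityMeasure P] {Δ : Fin K → Fin K → ℝ} (hΔ : R.IsStochasticallyConstrained Δ) {t : ℕ}
    (ht : t ∈ Finset.Icc 1 T) (i k : Fin K) :
    ∫ ω, (R.loss t ω i - R.loss t ω k) ∂P = Δ i k := by
  rw [← integral_condExp (R.history.le t), integral_congr_ae (hΔ t ht i k)]
  simp

theorem gap_le_one [IsProbabilityMeasure P] {Δ : Fin K → Fin K → ℝ} (hΔ : R.IsStochasticallyConstrained Δ) {t : ℕ}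
    (ht : t ∈ Finset.Icc 1 T) (i k : Fin K) : Δ i k ≤ 1 := by
  rw [← R.integral_loss_sub hΔ ht]
  have h := integral_mono (μ := P)
    ((R.integrable_loss_apply ht i).sub (R.integrable_loss_apply ht k)) (integrable_const (1 : ℝ))
    fun ω => by
      have h1 := (R.loss_mem t ht ω i).2
      have h2 := (R.loss_mem t ht ω k).1
      simp only [Pi.sub_apply]; linarith
  simpa using h

theorem win_nonneg (t : ℕ) (ω : Ω) (i : Fin K) : 0 ≤ R.win t ω i := winProb_nonneg _ _

variable [hα : Fact (1 < α)]

theorem win_le_one (t : ℕ) (ω : Ω) (i : Fin K) : R.win t ω i ≤ 1 := winProb_le_one _ _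

theorem abs_win_le (t : ℕ) (ω : Ω) (i : Fin K) : |R.win t ω i| ≤ 1 := by
  rw [abs_of_nonneg (R.win_nonneg t ω i)]; exact R.win_le_one t ω i

theorem measurable_win' {t : ℕ} (ht : t ∈ Finset.Icc 1 T) (i : Fin K) :
    Measurable fun ω => R.win t ω i := (R.measurable_win ht i).mono (R.history.le t) le_rfl

/-- The probability that fresh perturbations with the learning rate of round `t` make the arm `i`
the leader once the loss estimates of round `t` are included. -/
noncomputable def winNext (R : FTPLRun P K T α η) (t : ℕ) (ω : Ω) (i : Fin K) : ℝ :=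
  winProb α (η t • R.lhat (t + 1) ω) i

theorem measurable_winNext {t : ℕ} (ht : t ∈ Finset.Icc 1 T) (i : Fin K) :
    Measurable fun ω => R.winNext t ω i := by
  obtain ⟨h1, h2⟩ := Finset.mem_Icc.1 ht
  exact (measurable_winProb i).comp ((measurable_const_smul (η t)).comp
    ((R.measurable_lhat (by omega) (by omega)).mono (R.history.le _) le_rfl))

theorem abs_winNext_le (t : ℕ) (ω : Ω) (i : Fin K) : |R.winNext t ω i| ≤ 1 :=
  (abs_of_nonneg (winProb_nonneg _ _)).trans_le (winProb_le_one _ _)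

variable [IsProbabilityMeasure P]

theorem integrable_win {t : ℕ} (ht : t ∈ Finset.Icc 1 T) (i : Fin K) :
    Integrable (fun ω => R.win t ω i) P :=
  Integrable.of_bound (R.measurable_win' ht i).aestronglyMeasurable 1
    (ae_of_all _ fun ω => R.abs_win_le t ω i)

theorem integrable_loss_mul_win {t : ℕ} (ht : t ∈ Finset.Icc 1 T) (i j : Fin K) :
    Integrable (fun ω => R.loss t ω i * R.win t ω j) P :=
  (R.integrable_win ht j).bdd_mul (R.measurable_loss_apply ht i).aestronglyMeasurable
    (ae_of_all _ fun ω => R.abs_loss_le ht ω i)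

/-- The expected excess loss, over that of the arm `k`, of playing the fresh perturbed leader in
round `t`. -/
noncomputable def excess (P : Measure Ω) {K T : ℕ} {α : ℝ} {η : ℕ → ℝ} (R : FTPLRun P K T α η)
    (t : ℕ) (k : Fin K) : ℝ :=
  ∑ i, ∫ ω, R.loss t ω i * R.win t ω i ∂P - ∫ ω, R.loss t ω k ∂P

theorem excess_eq {Δ : Fin K → Fin K → ℝ} (hΔ : R.IsStochasticallyConstrained Δ) {t : ℕ}
    (ht : t ∈ Finset.Icc 1 T) (k : Fin K) :
    R.excess P t k = ∑ i ∈ Finset.univ.erase k, Δ i k * ∫ ω, R.win t ω i ∂P := by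
  have hne : Nonempty (Fin K) := ⟨k⟩
  have h1 : ∫ ω, R.loss t ω k ∂P = ∑ i, ∫ ω, R.loss t ω k * R.win t ω i ∂P := by
    rw [← integral_finsetSum _ fun i _ => R.integrable_loss_mul_win ht k i]
    refine integral_congr_ae (ae_of_all _ fun ω => ?_)
    simp only
    rw [← Finset.mul_sum]
    simp only [win, sum_winProb, mul_one]
  have h2 : ∀ i, ∫ ω, R.loss t ω i * R.win t ω i ∂P - ∫ ω, R.loss t ω k * R.win t ω i ∂P
      = ∫ ω, R.win t ω i * (R.loss t ω i - R.loss t ω k) ∂P := fun i => by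
    rw [← integral_sub (R.integrable_loss_mul_win ht i i) (R.integrable_loss_mul_win ht k i)]
    exact integral_congr_ae (ae_of_all _ fun ω => by simp only; ring)
  rw [excess, h1, ← Finset.sum_sub_distrib]
  simp_rw [h2]
  rw [← Finset.add_sum_erase _ _ (Finset.mem_univ k)]
  simp only [sub_self, mul_zero, integral_zero, zero_add]
  exact Finset.sum_congr rfl fun i _ => R.integral_loss_sub_mul_win hΔ ht i k

theorem pseudoRegret_le_sum_excess {Δ : Fin K → Fin K → ℝ} (hΔ : R.IsStochasticallyConstrained Δ)
    (hη : ∀ t ∈ Finset.Icc 1 T, 0 < η t) (k : Fin K) (hk : ∀ i, i ≠ k → 0 < Δ i k) :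
    R.pseudoRegret ≤ ∑ t ∈ Finset.Icc 1 T, R.excess P t k := by
  have hne : Nonempty (Fin K) := ⟨k⟩
  have hsum : ∀ i, ∫ ω, ∑ t ∈ Finset.Icc 1 T, R.loss t ω i ∂P
      = ∑ t ∈ Finset.Icc 1 T, ∫ ω, R.loss t ω i ∂P := fun i =>
    integral_finsetSum _ fun t ht => R.integrable_loss_apply ht i
  have hbest : ∑ t ∈ Finset.Icc 1 T, ∫ ω, R.loss t ω k ∂P
      ≤ ⨅ i : Fin K, ∫ ω, ∑ t ∈ Finset.Icc 1 T, R.loss t ω i ∂P := by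
    refine le_ciInf fun i => ?_
    rw [hsum]
    by_cases hik : i = k
    · rw [hik]
    refine Finset.sum_le_sum fun t ht => ?_
    have h := R.integral_loss_sub hΔ ht i k
    rw [integral_sub (R.integrable_loss_apply ht i) (R.integrable_loss_apply ht k)] at h
    linarith [hk i hik]
  have hind : ∀ t ∈ Finset.Icc 1 T, ∀ i ∈ (Finset.univ : Finset (Fin K)),
      Integrable ((R.exploit t ⁻¹' {i}).indicator fun ω => R.loss t ω i) P := fun t ht i _ =>
    (R.integrable_loss_apply ht i).indicator (R.measurable_exploit' ht (measurableSet_singleton i))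
  have hexp : ∀ t ω, R.loss t ω (R.exploit t ω)
      = ∑ i, (R.exploit t ⁻¹' {i}).indicator (fun ω => R.loss t ω i) ω := fun t ω => by
    rw [Finset.sum_eq_single (R.exploit t ω)]
    · rw [Set.indicator_of_mem (by simp)]
    · intro i _ hi
      exact Set.indicator_of_notMem (by simpa using hi.symm) _
    · simp
  have hupper : ∫ ω, ∑ t ∈ Finset.Icc 1 T, R.loss t ω (R.exploit t ω) ∂P
      ≤ ∑ t ∈ Finset.Icc 1 T, ∑ i, ∫ ω, R.loss t ω i * R.win t ω i ∂P := by
    simp_rw [hexp]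
    rw [integral_finsetSum _ fun t ht => integrable_finsetSum _ (hind t ht)]
    refine Finset.sum_le_sum fun t ht => ?_
    rw [integral_finsetSum _ (hind t ht)]
    exact Finset.sum_le_sum fun i _ => R.integral_loss_indicator_exploit_le ht (hη t ht) i
  rw [pseudoRegret]
  simp only [excess, Finset.sum_sub_distrib]
  linarith

/-- Unbiasedness, also against factors `Z` that depend on the current losses; the stability estimate
needs this generality. -/
theorem integral_estimate_mul {t : ℕ} (hη : ∀ t ∈ Finset.Icc 1 T, 0 < η t)
    (ht : t ∈ Finset.Icc 1 T) (i : Fin K) {Z : Ω → ℝ} (hZ : Measurable[R.pastLoss t] Z)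
    (hB : ∀ ω, |Z ω| ≤ 1) :
    ∫ ω, R.estimate t ω i * Z ω ∂P = ∫ ω, R.loss t ω i * Z ω ∂P := by
  obtain ⟨p, hp, hpp⟩ := R.exists_le_prob (zero_lt_one.trans hα.out) hη ht
  rw [← R.integral_loss_mul ht hp (fun ω => hpp ω i) hZ hB]
  refine integral_congr_ae (ae_of_all _ fun ω => ?_)
  simp only
  rw [R.estimate_apply]
  by_cases h : ω ∈ R.explore t ⁻¹' {i}
  · rw [Set.indicator_of_mem h, Set.indicator_of_mem h]
  · rw [Set.indicator_of_notMem h, Set.indicator_of_notMem h, zero_mul]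

theorem integrable_estimate (hη : ∀ t ∈ Finset.Icc 1 T, 0 < η t) {t : ℕ}
    (ht : t ∈ Finset.Icc 1 T) (i : Fin K) : Integrable (fun ω => R.estimate t ω i) P := by
  obtain ⟨p, hp, hpp⟩ := R.exists_le_prob (zero_lt_one.trans hα.out) hη ht
  have e : (fun ω => R.estimate t ω i)
      = (R.explore t ⁻¹' {i}).indicator fun ω => R.loss t ω i / R.prob t ω i :=
    funext fun ω => R.estimate_apply t ω i
  rw [e]
  refine Integrable.indicator ?_ (R.measurable_explore' ht (measurableSet_singleton i))
  refine Integrable.of_bound (Measurable.aestronglyMeasurable ?_) (1 / p) (ae_of_all _ fun ω => ?_)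
  · exact (R.measurable_loss_apply ht i).div
      ((R.measurable_prob ht i).mono (R.history.le t) le_rfl)
  · obtain ⟨h0, h1⟩ := R.loss_mem t ht ω i
    rw [Real.norm_of_nonneg (div_nonneg h0 (hp.le.trans (hpp ω i)))]
    exact div_le_div₀ zero_le_one h1 hp (hpp ω i)

theorem integrable_estimate_mul_win (hη : ∀ t ∈ Finset.Icc 1 T, 0 < η t) {t : ℕ}
    (ht : t ∈ Finset.Icc 1 T) (i : Fin K) :
    Integrable (fun ω => R.estimate t ω i * R.win t ω i) P :=
  (R.integrable_estimate hη ht i).mul_bdd (R.measurable_win' ht i).aestronglyMeasurable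
    (ae_of_all _ fun ω => R.abs_win_le t ω i)

theorem integrable_estimate_mul_winNext (hη : ∀ t ∈ Finset.Icc 1 T, 0 < η t) {t : ℕ}
    (ht : t ∈ Finset.Icc 1 T) (i : Fin K) :
    Integrable (fun ω => R.estimate t ω i * R.winNext t ω i) P :=
  (R.integrable_estimate hη ht i).mul_bdd (R.measurable_winNext ht i).aestronglyMeasurable
    (ae_of_all _ fun ω => R.abs_winNext_le t ω i)

theorem integrable_stability {t : ℕ} (ht : t ∈ Finset.Icc 1 T) (i : Fin K) :
    Integrable (fun ω => R.win t ω i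
      - winProb α (η t • R.lhat t ω + Pi.single i (η t / R.prob t ω i)) i) P := by
  have hm : Measurable fun ω =>
      winProb α (η t • R.lhat t ω + Pi.single i (η t / R.prob t ω i)) i :=
    measurable_winProb_add_single ((R.measurable_smul_lhat ht).mono (R.history.le t) le_rfl)
      (measurable_const.div ((R.measurable_prob ht i).mono (R.history.le t) le_rfl)) i
  exact (R.integrable_win ht i).sub (Integrable.of_bound hm.aestronglyMeasurable 1
    (ae_of_all _ fun ω => (Real.norm_of_nonneg (winProb_nonneg _ _)).trans_le (winProb_le_one _ _)))

/-- The estimate of arm `i` is nonzero only if `i` is explored, and then `i` is the only arm that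
moves. The updated winning probability can thus be replaced by `Y`, a function of past and losses,
before unbiasedness is used; bounding the loss by `1` gives the maximal shift. -/
theorem integral_estimate_mul_sub_le (hη : ∀ t ∈ Finset.Icc 1 T, 0 < η t) {t : ℕ}
    (ht : t ∈ Finset.Icc 1 T) (i : Fin K) :
    ∫ ω, R.estimate t ω i * (R.win t ω i - R.winNext t ω i) ∂P
      ≤ ∫ ω, (R.win t ω i
          - winProb α (η t • R.lhat t ω + Pi.single i (η t / R.prob t ω i)) i) ∂P := by
  obtain ⟨p, hp, hpp⟩ := R.exists_le_prob (zero_lt_one.trans hα.out) hη ht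
  have hη0 := (hη t ht).le
  set Y : Ω → ℝ := fun ω => R.win t ω i
    - winProb α (η t • R.lhat t ω + Pi.single i (η t * (R.loss t ω i / R.prob t ω i))) i with hY
  have hprob : Measurable[R.pastLoss t] fun ω => R.prob t ω i :=
    (R.measurable_prob ht i).mono (R.history_le_pastLoss t) le_rfl
  have hℓ : Measurable[R.pastLoss t] fun ω => R.loss t ω i :=
    (measurable_pi_apply i).comp (R.measurable_loss_pastLoss t)
  have hYm : Measurable[R.pastLoss t] Y :=
    ((R.measurable_win ht i).mono (R.history_le_pastLoss t) le_rfl).sub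
      (measurable_winProb_add_single
        ((R.measurable_smul_lhat ht).mono (R.history_le_pastLoss t) le_rfl)
        (measurable_const.mul (hℓ.div hprob)) i)
  have hx0 : ∀ ω, 0 ≤ R.loss t ω i / R.prob t ω i := fun ω =>
    div_nonneg (R.loss_mem t ht ω i).1 (hp.le.trans (hpp ω i))
  have hY0 : ∀ ω, 0 ≤ Y ω := fun ω => by
    have := winProb_anti (α := α) (η t • R.lhat t ω) i (mul_nonneg hη0 (hx0 ω))
    rw [Pi.single_zero, add_zero] at this
    exact sub_nonneg.2 this
  have hY1 : ∀ ω, Y ω ≤ 1 := fun ω =>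
    (sub_le_self _ (winProb_nonneg _ _)).trans (R.win_le_one t ω i)
  have hYabs : ∀ ω, |Y ω| ≤ 1 := fun ω => by rw [abs_of_nonneg (hY0 ω)]; exact hY1 ω
  have e : ∫ ω, R.estimate t ω i * (R.win t ω i - R.winNext t ω i) ∂P
      = ∫ ω, R.estimate t ω i * Y ω ∂P := by
    refine integral_congr_ae (ae_of_all _ fun ω => ?_)
    simp only [R.estimate_apply]
    by_cases h : R.explore t ω = i
    · rw [Set.indicator_of_mem (by simpa using h)]
      congr 2
      rw [winNext, R.lhat_succ' ht, smul_add, estimate, h, ← Pi.single_smul, smul_eq_mul]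
    · rw [Set.indicator_of_notMem (by simpa using h), zero_mul, zero_mul]
  rw [e, R.integral_estimate_mul hη ht i hYm hYabs]
  refine integral_mono_of_nonneg (ae_of_all _ fun ω => ?_) ?_ (ae_of_all _ fun ω => ?_)
  · exact mul_nonneg (R.loss_mem t ht ω i).1 (hY0 ω)
  · exact R.integrable_stability ht i
  · obtain ⟨h0, h1⟩ := R.loss_mem t ht ω i
    refine (mul_le_of_le_one_left (hY0 ω) h1).trans (sub_le_sub_left (winProb_anti _ _ ?_) _)
    rw [← mul_div_assoc]
    exact div_le_div_of_nonneg_right (mul_le_of_le_one_right hη0 h1) (hp.le.trans (hpp ω i))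

theorem integrable_rpow_win {t : ℕ} (ht : t ∈ Finset.Icc 1 T) (i : Fin K) :
    Integrable (fun ω => R.win t ω i ^ (1 - 1 / α)) P := by
  have hα1 : 1 < α := hα.out
  refine Integrable.of_bound ((R.measurable_win' ht i).pow_const _).aestronglyMeasurable 1
    (ae_of_all _ fun ω => ?_)
  rw [Real.norm_of_nonneg (Real.rpow_nonneg (R.win_nonneg t ω i) _)]
  refine Real.rpow_le_one (R.win_nonneg t ω i) (R.win_le_one t ω i) ?_
  rw [sub_nonneg, div_le_one (by linarith)]; exact hα1.le

/-- After passing to estimates, `winNext` is inserted: the differences `win - winNext` form the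
stability, and be-the-leader applies pathwise to the rest. -/
theorem sum_excess_le (hη : ∀ t ∈ Finset.Icc 1 T, 0 < η t) {b : ℕ → ℝ} (hb0 : b 0 = 0)
    (hb : ∀ t ∈ Finset.Icc 1 T, 0 < b t) (hηb : ∀ t ∈ Finset.Icc 1 T, η t * b t = 1)
    (hmono : Monotone b) (k : Fin K) :
    ∑ t ∈ Finset.Icc 1 T, R.excess P t k
      ≤ ∑ t ∈ Finset.Icc 1 T, ∫ ω, stability α (η t) (R.lhat t ω) (R.rank t ω) ∂P
        + ∑ t ∈ Finset.Icc 1 T, ∑ i ∈ Finset.univ.erase k,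
            ∫ ω, (b t - b (t - 1)) * (tailConst α * R.win t ω i ^ (1 - 1 / α)) ∂P := by
  have hest := fun t ht i => R.integrable_estimate hη (t := t) ht i
  have hew := fun t ht i => R.integrable_estimate_mul_win hη (t := t) ht i
  have hewn := fun t ht i => R.integrable_estimate_mul_winNext hη (t := t) ht i
  have hexc : ∀ t ∈ Finset.Icc 1 T, R.excess P t k
      = ∑ i, ∫ ω, R.estimate t ω i * (R.win t ω i - R.winNext t ω i) ∂P
        + ∫ ω, (∑ i, R.estimate t ω i * R.winNext t ω i - R.estimate t ω k) ∂P := by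
    intro t ht
    have h1 : ∀ i, ∫ ω, R.loss t ω i * R.win t ω i ∂P = ∫ ω, R.estimate t ω i * R.win t ω i ∂P :=
      fun i => (R.integral_estimate_mul hη ht i ((R.measurable_win ht i).mono
        (R.history_le_pastLoss t) le_rfl) (R.abs_win_le t · i)).symm
    have h2 : ∫ ω, R.loss t ω k ∂P = ∫ ω, R.estimate t ω k ∂P := by
      have := R.integral_estimate_mul hη ht k (Z := fun _ => 1) measurable_const (by simp)
      simpa using this.symm
    rw [excess, h2, integral_sub (integrable_finsetSum _ fun i _ => hewn t ht i) (hest t ht k),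
      integral_finsetSum _ fun i _ => hewn t ht i, ← add_sub_assoc, ← Finset.sum_add_distrib]
    congr 1
    refine Finset.sum_congr rfl fun i _ => ?_
    simp_rw [mul_sub]
    rw [h1, integral_sub (hew t ht i) (hewn t ht i), sub_add_cancel]
  rw [Finset.sum_congr rfl hexc, Finset.sum_add_distrib]
  refine add_le_add (Finset.sum_le_sum fun t ht => ?_) ?_
  · have : ∀ ω, stability α (η t) (R.lhat t ω) (R.rank t ω) = ∑ i, (R.win t ω i
      - winProb α (η t • R.lhat t ω + Pi.single i (η t / R.prob t ω i)) i) := fun ω => rfl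
    simp_rw [this]
    rw [integral_finsetSum _ fun i _ => R.integrable_stability ht i]
    exact Finset.sum_le_sum fun i _ => R.integral_estimate_mul_sub_le hη ht i
  · have hint1 : ∀ t ∈ Finset.Icc 1 T, Integrable (fun ω =>
        ∑ i, R.estimate t ω i * R.winNext t ω i - R.estimate t ω k) P := fun t ht =>
      (integrable_finsetSum _ fun i _ => hewn t ht i).sub (hest t ht k)
    have hint2 : ∀ t ∈ Finset.Icc 1 T, ∀ i ∈ Finset.univ.erase k, Integrable (fun ω =>
        (b t - b (t - 1)) * (tailConst α * R.win t ω i ^ (1 - 1 / α))) P := fun t ht i _ =>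
      ((R.integrable_rpow_win ht i).const_mul _).const_mul _
    rw [← integral_finsetSum _ hint1,
      Finset.sum_congr rfl fun t ht => (integral_finsetSum _ (hint2 t ht)).symm,
      ← integral_finsetSum _ fun t ht => integrable_finsetSum _ (hint2 t ht)]
    refine integral_mono (integrable_finsetSum _ hint1)
      (integrable_finsetSum _ fun t ht => integrable_finsetSum _ (hint2 t ht)) fun ω => ?_
    have hbtl := sum_mul_winProb_le (α := α) (L := fun t => R.lhat t ω)
      (v := fun t => R.estimate t ω) (R.lhat_one ω) (fun t ht => R.lhat_succ' ht ω) hb0 hb hηb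
      (fun t => hmono (Nat.sub_le t 1)) k
    rw [R.lhat_apply_eq_sum_estimate le_rfl, Finset.sum_apply] at hbtl
    simp only [Finset.sum_sub_distrib]
    simp only [Finset.mul_sum] at hbtl
    exact sub_le_iff_le_add'.2 hbtl

end FTPLRun

/-! ### Self-bounding of the regret -/

namespace FTPLRun

variable {α c : ℝ} [hα : Fact (1 < α)]

theorem exists_integral_stability_le (hα3 : α ≤ 3) (hc : 0 < c) :
    ∃ C : ℝ, 0 < C ∧ ∀ {Ω : Type*} [MeasurableSpace Ω] {P : Measure Ω} [IsProbabilityMeasure P]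
      {K T : ℕ} [Nontrivial (Fin K)]
      (R : FTPLRun P K T α (fun t => c * (K : ℝ) ^ (1 / α - 1 / 2) / √(t : ℝ)))
      (t : ℕ) (_ : t ∈ Finset.Icc 1 T) (D : ℝ) (k : Fin K), 0 < D → D ≤ 1 →
        ∫ ω, stability α (c * (K : ℝ) ^ (1 / α - 1 / 2) / √(t : ℝ)) (R.lhat t ω) (R.rank t ω) ∂P
          ≤ D * (∑ i ∈ Finset.univ.erase k, ∫ ω, R.win t ω i ∂P) / 4
            + C * (D * min (√(K : ℝ) / D / √(t : ℝ)) ((√(K : ℝ) / D / √(t : ℝ)) ^ 3)) := by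
  have hα1 : 1 < α := hα.out
  obtain ⟨C, hC, h⟩ := exists_stability_le hα3 hc
  refine ⟨C, hC, ?_⟩
  intro Ω _ P _ K T _ R t ht D k hD0 hD1
  have hK : (0 : ℝ) < K := by exact_mod_cast k.pos
  have ht0 : 0 < √(t : ℝ) := Real.sqrt_pos.2 (by exact_mod_cast (Finset.mem_Icc.1 ht).1)
  have hη : 0 ≤ c * (K : ℝ) ^ (1 / α - 1 / 2) / √(t : ℝ) := by positivity
  have hv : c * (K : ℝ) ^ (1 / α - 1 / 2) / √(t : ℝ) * (K : ℝ) ^ (1 - 1 / α)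
      ≤ c * (√(K : ℝ) / √(t : ℝ)) := by
    have e : (K : ℝ) ^ (1 / α - 1 / 2) * (K : ℝ) ^ (1 - 1 / α) = √(K : ℝ) := by
      rw [← Real.rpow_add hK, Real.sqrt_eq_rpow]; congr 1; ring
    rw [← e]
    exact le_of_eq (by ring)
  have hne : Nonempty (Fin K) := ⟨k⟩
  have hW : ∀ ω, 1 - R.win t ω k = ∑ i ∈ Finset.univ.erase k, R.win t ω i := fun ω => by
    have : ∑ i, R.win t ω i = 1 := sum_winProb _
    rw [← Finset.add_sum_erase _ _ (Finset.mem_univ k)] at this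
    linarith
  have hpt : ∀ ω, stability α (c * (K : ℝ) ^ (1 / α - 1 / 2) / √(t : ℝ)) (R.lhat t ω) (R.rank t ω)
      ≤ D * (∑ i ∈ Finset.univ.erase k, R.win t ω i) / 4
        + C * (D * min (√(K : ℝ) / D / √(t : ℝ)) ((√(K : ℝ) / D / √(t : ℝ)) ^ 3)) := fun ω => by
    have h1 := h K _ (R.lhat t ω) (R.rank t ω) _ D k hη (R.isRanking t ht ω) hv (by positivity)
      hD0 hD1
    rw [div_right_comm (√(K : ℝ)) D, ← hW]
    exact h1
  have hint : Integrable (fun ω => ∑ i ∈ Finset.univ.erase k, R.win t ω i) P :=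
    integrable_finsetSum _ fun i _ => R.integrable_win ht i
  have hsint : Integrable (fun ω => stability α (c * (K : ℝ) ^ (1 / α - 1 / 2) / √(t : ℝ))
      (R.lhat t ω) (R.rank t ω)) P :=
    integrable_finsetSum _ fun i _ => R.integrable_stability ht i
  refine (integral_mono hsint
    (((hint.const_mul D).div_const 4).add (integrable_const _)) hpt).trans (le_of_eq ?_)
  simp only [Pi.add_apply]
  rw [integral_add ((hint.const_mul D).div_const 4) (integrable_const _), integral_div,
    integral_const_mul, integral_finsetSum _ fun i _ => R.integrable_win ht i]
  simp

theorem exists_pseudoRegret_le (hα3 : α ≤ 3) (hc : 0 < c) :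
    ∃ C : ℝ, 0 < C ∧ ∀ {Ω : Type*} [MeasurableSpace Ω] {P : Measure Ω} [IsProbabilityMeasure P]
      {K T : ℕ} [Nontrivial (Fin K)]
      (R : FTPLRun P K T α (fun t => c * (K : ℝ) ^ (1 / α - 1 / 2) / √(t : ℝ)))
      (Δ : Fin K → Fin K → ℝ) (k : Fin K) (D : ℝ), R.IsStochasticallyConstrained Δ → 0 < D →
      (∀ i, i ≠ k → D ≤ Δ i k) →
        R.pseudoRegret ≤ C * ((∑ t ∈ Finset.Icc 1 T, ∑ i ∈ Finset.univ.erase k,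
          √(K : ℝ) * Δ i k ^ (1 - α) * (t : ℝ) ^ (-α / 2)) + K / D) := by
  have hα1 : 1 < α := hα.out
  obtain ⟨C, hC, h⟩ := exists_integral_stability_le hα3 hc
  set Cp := 4 ^ (α - 1) * (tailConst α / c) ^ α with hCp
  have htc : 0 < tailConst α := by
    have : 0 < α - 1 := by linarith
    unfold tailConst; positivity
  have hCp0 : 0 < Cp := by positivity
  refine ⟨2 * Cp + 12 * C, by positivity, ?_⟩
  intro Ω _ P _ K T _ R Δ k D hΔ hD0 hD
  have hKn : 0 < K := k.pos
  have hK : (1 : ℝ) ≤ K := by exact_mod_cast hKn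
  have hK0 : (0 : ℝ) < K := by linarith
  have hpos : ∀ i, i ≠ k → 0 < Δ i k := fun i hi => hD0.trans_le (hD i hi)
  have ht0 : ∀ t ∈ Finset.Icc 1 T, 0 < t := fun t ht => (Finset.mem_Icc.1 ht).1
  have hη : ∀ t ∈ Finset.Icc 1 T, 0 < c * (K : ℝ) ^ (1 / α - 1 / 2) / √(t : ℝ) := fun t ht => by
    have : 0 < √(t : ℝ) := Real.sqrt_pos.2 (by exact_mod_cast ht0 t ht)
    positivity
  set S := ∑ t ∈ Finset.Icc 1 T, ∑ i ∈ Finset.univ.erase k,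
    √(K : ℝ) * Δ i k ^ (1 - α) * (t : ℝ) ^ (-α / 2) with hS
  have hS0 : 0 ≤ S := Finset.sum_nonneg fun t _ => Finset.sum_nonneg fun i hi => by
    have := hpos i (Finset.ne_of_mem_erase hi)
    positivity
  set X := ∑ t ∈ Finset.Icc 1 T, ∑ i ∈ Finset.univ.erase k, Δ i k * ∫ ω, R.win t ω i ∂P with hX
  have hsum : ∑ t ∈ Finset.Icc 1 T, R.excess P t k = X :=
    Finset.sum_congr rfl fun t ht => R.excess_eq hΔ ht k
  have hreg : R.pseudoRegret ≤ X := hsum ▸ R.pseudoRegret_le_sum_excess hΔ hη k hpos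
  have hdec := R.sum_excess_le hη (b := invRate α c K) (invRate_zero α c K)
    (fun t ht => invRate_pos hc hKn (ht0 t ht)) (fun t ht => rate_mul_invRate hc hKn (ht0 t ht))
    (invRate_mono hc K) k
  rw [hsum] at hdec
  have hpen : ∑ t ∈ Finset.Icc 1 T, ∑ i ∈ Finset.univ.erase k,
      ∫ ω, (invRate α c K t - invRate α c K (t - 1)) *
        (tailConst α * R.win t ω i ^ (1 - 1 / α)) ∂P ≤ X / 4 + Cp * S := by
    rw [hX, hS, Finset.sum_div, Finset.mul_sum, ← Finset.sum_add_distrib]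
    refine Finset.sum_le_sum fun t ht => ?_
    rw [Finset.sum_div, Finset.mul_sum, ← Finset.sum_add_distrib]
    refine Finset.sum_le_sum fun i hi => ?_
    have hint := R.integrable_win ht i
    refine (integral_mono (((R.integrable_rpow_win ht i).const_mul _).const_mul _)
      (((hint.const_mul (Δ i k)).div_const 4).add (integrable_const _)) fun ω =>
        invRate_sub_mul_le hα1 hα3 hc hKn (hpos i (Finset.ne_of_mem_erase hi))
          (R.win_nonneg t ω i)).trans (le_of_eq ?_)
    simp only [Pi.add_apply]
    rw [integral_add ((hint.const_mul _).div_const 4) (integrable_const _), integral_div,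
      integral_const_mul, integral_const, probReal_univ, one_smul]
  have hstab : ∑ t ∈ Finset.Icc 1 T, ∫ ω, stability α
      (c * (K : ℝ) ^ (1 / α - 1 / 2) / √(t : ℝ)) (R.lhat t ω) (R.rank t ω) ∂P
        ≤ X / 4 + C * (6 * (K / D)) := by
    -- Without any round the gaps are not tied to losses and `D ≤ 1` may fail, so `T = 0` is
    -- separate.
    rcases Nat.eq_zero_or_pos T with rfl | hT
    · simp only [hX, Finset.Icc_eq_empty_of_lt Nat.zero_lt_one, Finset.sum_empty]
      positivity
    obtain ⟨j, hj⟩ := exists_ne k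
    have hD1 : D ≤ 1 := (hD j hj).trans (R.gap_le_one hΔ (Finset.mem_Icc.2 ⟨le_rfl, hT⟩) j k)
    have ha : 1 ≤ √(K : ℝ) / D := by
      rw [le_div_iff₀ hD0]
      have : 1 ≤ √(K : ℝ) := Real.one_le_sqrt.2 hK
      linarith
    have hround : ∀ t ∈ Finset.Icc 1 T, ∫ ω, stability α
        (c * (K : ℝ) ^ (1 / α - 1 / 2) / √(t : ℝ)) (R.lhat t ω) (R.rank t ω) ∂P
          ≤ (∑ i ∈ Finset.univ.erase k, Δ i k * ∫ ω, R.win t ω i ∂P) / 4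
            + C * (D * min (√(K : ℝ) / D / √(t : ℝ)) ((√(K : ℝ) / D / √(t : ℝ)) ^ 3)) := by
      intro t ht
      refine (h R t ht D k hD0 hD1).trans ?_
      gcongr
      rw [Finset.mul_sum]
      refine Finset.sum_le_sum fun i hi => ?_
      exact mul_le_mul_of_nonneg_right (hD i (Finset.ne_of_mem_erase hi))
        (integral_nonneg fun ω => R.win_nonneg t ω i)
    refine (Finset.sum_le_sum hround).trans ?_
    rw [Finset.sum_add_distrib, ← Finset.sum_div, ← Finset.mul_sum, ← Finset.mul_sum]
    have h1 := sum_min_div_sqrt_le ha T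
    have h2 : D * (6 * (√(K : ℝ) / D) ^ 2) = 6 * (K / D) := by
      rw [div_pow, Real.sq_sqrt hK0.le]; field_simp
    rw [← h2]
    gcongr
  have hKD : 0 ≤ K / D := by positivity
  -- `X ≤ X / 2 + Cp * S + 6 * C * (K / D)`, solved for `X`.
  have hfin : X ≤ 2 * Cp * S + 12 * C * (K / D) := by linarith
  refine hreg.trans (hfin.trans ?_)
  have h1 : 0 ≤ 12 * C * S := by positivity
  have h2 : 0 ≤ 2 * Cp * (K / D) := by positivity
  linarith

end FTPLRun

theorem theorem2 (α c : ℝ) (hα : 1 < α) (hα3 : α ≤ 3) (hc : 0 < c) :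
    ∃ C : ℝ, 0 < C ∧
      ∀ (K T : ℕ) (_hK : 2 ≤ K)
        (Ω : Type*) [MeasurableSpace Ω] (P : Measure Ω) [IsProbabilityMeasure P]
        (R : FTPLRun P K T α (fun t => c * (K : ℝ) ^ (1 / α - 1 / 2) / √(t : ℝ)))
        (Δ : Fin K → Fin K → ℝ) (iStar : Fin K),
        R.IsStochasticallyConstrained Δ →
        (∀ i, i ≠ iStar → 0 < Δ i iStar) →
        R.pseudoRegret ≤
            C * ((∑ t ∈ Finset.Icc 1 T, ∑ i ∈ Finset.univ.erase iStar,
                  √(K : ℝ) * Δ i iStar ^ (1 - α) * (t : ℝ) ^ (-α / 2))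
                + K / (⨅ i : {i : Fin K // i ≠ iStar}, Δ i iStar)) ∧
          (2 < α →
            R.pseudoRegret ≤
              C * ((∑ i ∈ Finset.univ.erase iStar, √(K : ℝ) * Δ i iStar ^ (1 - α))
                + K / (⨅ i : {i : Fin K // i ≠ iStar}, Δ i iStar))) := by
  have : Fact (1 < α) := ⟨hα⟩
  obtain ⟨C, hC, h⟩ := FTPLRun.exists_pseudoRegret_le hα3 hc
  -- Only `2 < α` uses the value of this series; its term at `n = 0` is zero. For `α ≤ 2` it
  -- diverges and `Z` is `0` by convention, which leaves the constant `C`.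
  set Z := ∑' n : ℕ, (n : ℝ) ^ (-α / 2) with hZ
  have hZ0 : 0 ≤ Z := tsum_nonneg fun n => by positivity
  refine ⟨C * (1 + Z), by positivity, ?_⟩
  intro K T hK Ω _ P _ R Δ k hΔ hpos
  have hnt : Nontrivial (Fin K) := Fin.nontrivial_iff_two_le.2 hK
  set D := ⨅ i : {i : Fin K // i ≠ k}, Δ i k with hD
  obtain ⟨j, hj⟩ := exists_ne k
  have hne : Nonempty {i : Fin K // i ≠ k} := ⟨⟨j, hj⟩⟩
  have hD0 : 0 < D := by
    obtain ⟨i, hi⟩ := exists_eq_ciInf_of_finite (f := fun i : {i : Fin K // i ≠ k} => Δ i k)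
    rw [hD, ← hi]; exact hpos i i.2
  have hDle : ∀ i, i ≠ k → D ≤ Δ i k := fun i hi =>
    ciInf_le (f := fun i : {i : Fin K // i ≠ k} => Δ i k) (Set.finite_range _).bddBelow ⟨i, hi⟩
  have hmain := h R Δ k D hΔ hD0 hDle
  have hKD : 0 ≤ K / D := by positivity
  have hterm : ∀ i ∈ Finset.univ.erase k, 0 ≤ √(K : ℝ) * Δ i k ^ (1 - α) := fun i hi => by
    have := hpos i (Finset.ne_of_mem_erase hi)
    positivity
  refine ⟨hmain.trans ?_, fun hα2 => hmain.trans ?_⟩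
  · refine mul_le_mul_of_nonneg_right (le_mul_of_one_le_right hC.le (by linarith))
      (add_nonneg (Finset.sum_nonneg fun t _ => Finset.sum_nonneg fun i hi => ?_) hKD)
    exact mul_nonneg (hterm i hi) (by positivity)
  · set S := ∑ i ∈ Finset.univ.erase k, √(K : ℝ) * Δ i k ^ (1 - α) with hS
    have hS0 : 0 ≤ S := Finset.sum_nonneg hterm
    have hsum : Summable fun n : ℕ => (n : ℝ) ^ (-α / 2) :=
      Real.summable_nat_rpow.2 (by linarith)
    have h1 : ∑ t ∈ Finset.Icc 1 T, ∑ i ∈ Finset.univ.erase k,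
        √(K : ℝ) * Δ i k ^ (1 - α) * (t : ℝ) ^ (-α / 2) ≤ S * Z := by
      simp_rw [← Finset.sum_mul]
      rw [← Finset.mul_sum]
      exact mul_le_mul_of_nonneg_left (hsum.sum_le_tsum _ fun n _ => by positivity) hS0
    rw [mul_assoc]
    refine mul_le_mul_of_nonneg_left ?_ hC.le
    nlinarith [mul_nonneg hZ0 hKD]
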